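/- Fix $n\ge 1$. Let $\mathscr U$ be the category whose objects are finite sets $S=S_1\sqcup\cdots\sqcup S_n$ (elements of $S_i$ have weight $i$) and whose morphisms are bijections that do not decrease weights. A $\mathscr U$-module is a functor from $\mathscr U$ to finite-dimensional complex vector spaces that is nonzero on only finitely many objects up to isomorphism; with natural transformations as morphisms these form the abelian category $\mathrm{Mod}_{\mathscr U}$. For $\underline a=(a_1,\dots,a_n)\in\mathbf N^n$ write $\underline a$ also for the weighted set $([a_1],\dots,[a_n])$ in which the elements of $[a_i]$ have weight $i$, and put $\mathfrak S_{\underline a}=\mathfrak S_{a_1}\times\cdots\times\mathfrak S_{a_n}$, the automorphism group of $\underline a$. Let $\mathbf P_{\underline a}$ and $\mathbf I_{\underline a}$ be the $\mathscr U$-modules $\mathbf P_{\underline a}(T)=\mathbf C[\mathrm{Hom}_{\mathscr U}(\underline a,T)]$ and $\mathbf I_{\underline a}(T)=\mathbf C[\mathrm{Hom}_{\mathscr U}(T,\underline a)]^*$, on which $\mathfrak S_{\underline a}$ acts through its action on $\underline a$. For an $n$-tuple of partitions $\underline\lambda=(\lambda^1,\dots,\lambda^n)$ with $|\lambda^i|=a_i$,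 let $\mathbf M_{\underline\lambda}=M_{\lambda^1}\boxtimes\cdots\boxtimes M_{\lambda^n}$ be the external tensor product of complex Specht modules, a representation of $\mathfrak S_{\underline a}$, and put $$\mathbf P_{\underline\lambda}=\mathrm{Hom}_{\mathfrak S_{\underline a}}(\mathbf M_{\underline\lambda},\mathbf P_{\underline a}),\qquad \mathbf I_{\underline\lambda}=\mathrm{Hom}_{\mathfrak S_{\underline a}}(\mathbf M_{\underline\lambda},\mathbf I_{\underline a}).$$ Then: 1. The modules $\mathbf I_{\underline\lambda}$, where $\underline\lambda$ runs over all $n$-tuples of partitions, form a complete irredundant set of indecomposable injectives in $\mathrm{Mod}_{\mathscr U}$: each $\mathbf I_{\underline\lambda}$ is injective and indecomposable, every indecomposable injective object is isomorphic to some $\mathbf I_{\underline\lambda}$, and $\mathbf I_{\underline\lambda}\cong\mathbf I_{\underline\mu}$ only if $\underline\lambda=\underline\mu$. In the same sense, the modules $\mathbf P_{\underline\lambda}$ form a complete irredundant set of indecomposable projectives in $\mathrm{Mod}_{\mathscr U}$. 2. Every object of $\mathrm{Mod}_{\mathscr U}$ has finite injective dimension and finite projective dimension. -/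

import Mathlib

open CategoryTheory Limits
open scoped TensorProduct

noncomputable section

/-- A finite set together with a weight function to `{1, …, n}` (modelled by `Fin n`). -/
structure WeightedSet (n : ℕ) where
  carrier : Type
  [finite : Finite carrier]
  weight : carrier → Fin n

namespace WeightedSet

variable {n : ℕ}

attribute [instance] WeightedSet.finite

/-- An upwards morphism of weighted sets: a bijection which does not decrease weights. -/
@[ext]
structure Hom (S T : WeightedSet n) where
  toEquiv : S.carrier ≃ T.carrier
  le_weight : ∀ x, S.weight x ≤ T.weight (toEquiv x)

/-- The category `𝒰` of `[n]`-weighted finite sets and upwards bijections. -/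
instance : Category (WeightedSet n) where
  Hom := Hom
  id S := ⟨Equiv.refl _, fun _ => le_rfl⟩
  comp f g := ⟨f.toEquiv.trans g.toEquiv, fun x => (f.le_weight x).trans (g.le_weight _)⟩

@[ext]
theorem hom_ext {S T : WeightedSet n} {f g : S ⟶ T}
    (h : ∀ x, f.toEquiv x = g.toEquiv x) : f = g :=
  Hom.ext (Equiv.ext h)

instance (S T : WeightedSet n) : Finite (S ⟶ T) :=
  Finite.of_injective (fun f : S ⟶ T => f.toEquiv) (fun _ _ h => Hom.ext h)

/-- The weighted set `([a₁], …, [aₙ])`, in which `[aᵢ]` has weight `i`. -/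
def std (a : Fin n → ℕ) : WeightedSet n where
  carrier := Σ i, Fin (a i)
  weight := Sigma.fst

/-- The action of `𝔖_a = 𝔖_{a₁} × ⋯ × 𝔖_{aₙ}` on `([a₁], …, [aₙ])`. -/
def stdAct (a : Fin n → ℕ) (g : ∀ i, Equiv.Perm (Fin (a i))) : std a ⟶ std a :=
  ⟨Equiv.sigmaCongrRight g, fun _ => le_rfl⟩

theorem stdAct_one (a : Fin n → ℕ) : stdAct a 1 = 𝟙 (std a) := rfl

theorem stdAct_mul (a : Fin n → ℕ) (g h : ∀ i, Equiv.Perm (Fin (a i))) :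
    stdAct a (g * h) = stdAct a h ≫ stdAct a g := rfl

theorem exists_iso_std (T : WeightedSet n) : ∃ b : Fin n → ℕ, Nonempty (T ≅ std b) := by
  have e : ∀ i, {x : T.carrier // T.weight x = i} ≃
      Fin (Nat.card {x : T.carrier // T.weight x = i}) := fun i => Finite.equivFin _
  let E : T.carrier ≃ Σ i, Fin (Nat.card {x : T.carrier // T.weight x = i}) :=
    (Equiv.sigmaFiberEquiv T.weight).symm.trans (Equiv.sigmaCongrRight e)
  refine ⟨fun i => Nat.card {x : T.carrier // T.weight x = i}, ⟨⟨⟨E, fun _ => le_rfl⟩,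
    ⟨E.symm, fun y => ?_⟩, ?_, ?_⟩⟩⟩
  · obtain ⟨x, rfl⟩ := E.surjective y
    exact (congrArg T.weight (E.symm_apply_apply x)).ge
  · ext x; exact E.symm_apply_apply x
  · ext x; exact E.apply_symm_apply x

/-- There are finitely many weighted sets of a given cardinality, up to isomorphism. -/
theorem exists_finite_representatives (N : ℕ) : ∃ s : Set (WeightedSet n), s.Finite ∧
    ∀ T : WeightedSet n, Nat.card T.carrier = N → ∃ S ∈ s, Nonempty (T ≅ S) := by
  refine ⟨std '' (Set.Iic fun _ => N), (Set.finite_Iic _).image _, fun T hT => ?_⟩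
  obtain ⟨b, ⟨e⟩⟩ := exists_iso_std T
  refine ⟨std b, ⟨b, fun i => ?_, rfl⟩, ⟨e⟩⟩
  have h : Nat.card (std b).carrier = N := (Nat.card_congr e.hom.toEquiv).symm.trans hT
  have h' : ∑ j, b j = N := by simpa [std, Nat.card_sigma] using h
  rw [← h']
  exact Finset.single_le_sum (fun _ _ => Nat.zero_le _) (Finset.mem_univ i)

end WeightedSet

/-- A functor from `𝒰` to finite-dimensional complex vector spaces is supported on finitely many
objects up to isomorphism. -/
def HasFiniteSupport (n : ℕ) : ObjectProperty (WeightedSet n ⥤ FGModuleCat.{0} ℂ) := fun M =>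
  ∃ s : Set (WeightedSet n), s.Finite ∧
    ∀ T : WeightedSet n, Nontrivial (M.obj T) → ∃ S ∈ s, Nonempty (T ≅ S)

/-- The category `Mod_𝒰` of `𝒰`-modules: functors `𝒰 ⥤ Vec` of finite support, and natural
transformations. -/
abbrev UMod (n : ℕ) := (HasFiniteSupport n).FullSubcategory

namespace UMod

variable {n : ℕ}

theorem nontrivial_iff_not_isZero (V : FGModuleCat.{0} ℂ) :
    Nontrivial V ↔ ¬ IsZero V := by
  rw [← not_subsingleton_iff_nontrivial, not_iff_not]
  constructor
  · intro h
    rw [IsZero.iff_id_eq_zero]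
    ext x
    exact Subsingleton.elim _ _
  · intro h
    refine ⟨fun x y => ?_⟩
    have h0 : ∀ z : V, z = 0 := fun z =>
      congrArg (fun f : V ⟶ V => f.hom.hom z) ((IsZero.iff_id_eq_zero V).1 h)
    rw [h0 x, h0 y]

theorem hasFiniteSupport_of_isZero {M N : WeightedSet n ⥤ FGModuleCat.{0} ℂ}
    (hM : HasFiniteSupport n M)
    (h : ∀ T, IsZero (M.obj T) → IsZero (N.obj T)) : HasFiniteSupport n N := by
  obtain ⟨s, hs, hsM⟩ := hM
  refine ⟨s, hs, fun T hT => hsM T ?_⟩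
  rw [nontrivial_iff_not_isZero] at hT ⊢
  exact fun h' => hT (h T h')

instance : (HasFiniteSupport n).IsClosedUnderSubobjects where
  prop_of_mono f _ hN :=
    hasFiniteSupport_of_isZero hN fun T hT => IsZero.of_mono (f.app T) hT

instance : (HasFiniteSupport n).IsClosedUnderQuotients where
  prop_of_epi f _ hM :=
    hasFiniteSupport_of_isZero hM fun T hT => IsZero.of_epi (f.app T) hT

instance : (HasFiniteSupport n).ContainsZero where
  exists_zero := by
    obtain ⟨Z, hZ⟩ := HasZeroObject.zero (C := WeightedSet n ⥤ FGModuleCat.{0} ℂ)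
    exact ⟨Z, hZ, ∅, Set.finite_empty, fun T hT =>
      absurd ((Functor.isZero_iff _).1 hZ T) ((nontrivial_iff_not_isZero _).1 hT)⟩

instance : (HasFiniteSupport n).IsClosedUnderExtensions where
  prop_X₂_of_shortExact {S} hS h₁ h₃ := by
    obtain ⟨s₁, hs₁, hs₁'⟩ := h₁
    obtain ⟨s₃, hs₃, hs₃'⟩ := h₃
    refine ⟨s₁ ∪ s₃, hs₁.union hs₃, fun T hT => ?_⟩
    by_contra! hn
    have z₁ : IsZero (S.X₁.obj T) := by
      by_contra h
      obtain ⟨U, hU, e⟩ := hs₁' T ((nontrivial_iff_not_isZero _).2 h)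
      exact hn U (Or.inl hU) |>.false e.some
    have z₃ : IsZero (S.X₃.obj T) := by
      by_contra h
      obtain ⟨U, hU, e⟩ := hs₃' T ((nontrivial_iff_not_isZero _).2 h)
      exact hn U (Or.inr hU) |>.false e.some
    have := hS.mono_f
    have := hS.epi_g
    have hT' := hS.map ((evaluation (WeightedSet n) (FGModuleCat.{0} ℂ)).obj T)
    exact (nontrivial_iff_not_isZero _).1 hT (hT'.exact.isZero_of_both_isZero z₁ z₃)

instance : (HasFiniteSupport n).IsSerreClass where

instance : (HasFiniteSupport n).IsClosedUnderBinaryProducts where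
  limitsOfShape_le := by
    rintro X ⟨p⟩
    have hB := (IsLimit.postcomposeHomEquiv (diagramIsoPair p.diag) _).symm p.isLimit
    exact (HasFiniteSupport n).prop_of_iso
      ((BinaryBiproduct.isLimit _ _).conePointUniqueUpToIso hB)
      ((HasFiniteSupport n).prop_biprod (p.prop_diag_obj _) (p.prop_diag_obj _))

instance : (HasFiniteSupport n).IsClosedUnderFiniteProducts :=
  ObjectProperty.IsClosedUnderFiniteProducts.mk'

end UMod

/-! Specht modules. -/

/-- The group algebra of the symmetric group `𝔖_m`, where `m = |lam|`. -/
abbrev SymAlgebra (lam : YoungDiagram) := MonoidAlgebra ℂ (Equiv.Perm (Fin lam.card))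

/-- A tableau of shape `lam`, i.e. a numbering of its boxes. Any two choices give isomorphic Specht
modules. -/
def tableau (lam : YoungDiagram) : Fin lam.card ≃ lam.cells :=
  lam.cells.equivFin.symm

/-- The row stabilizer of the tableau. -/
def rowStabilizer (lam : YoungDiagram) : Set (Equiv.Perm (Fin lam.card)) :=
  {σ | ∀ x, (tableau lam (σ x)).1.1 = (tableau lam x).1.1}

/-- The column stabilizer of the tableau. -/
def colStabilizer (lam : YoungDiagram) : Set (Equiv.Perm (Fin lam.card)) :=
  {σ | ∀ x, (tableau lam (σ x)).1.2 = (tableau lam x).1.2}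

open Classical in
/-- The row symmetrizer `∑ σ`, over the row stabilizer. -/
def rowSymmetrizer (lam : YoungDiagram) : SymAlgebra lam :=
  ∑ σ with σ ∈ rowStabilizer lam, MonoidAlgebra.of ℂ _ σ

open Classical in
/-- The column antisymmetrizer `∑ sgn(σ) σ`, over the column stabilizer. -/
def colAntisymmetrizer (lam : YoungDiagram) : SymAlgebra lam :=
  ∑ σ with σ ∈ colStabilizer lam, ((Equiv.Perm.sign σ : ℤ) : ℂ) • MonoidAlgebra.of ℂ _ σ

/-- The Specht module of `lam`: the left ideal generated by the polytabloid
`colAntisymmetrizer * rowSymmetrizer`, inside the permutation module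
`ℂ[𝔖_m] * rowSymmetrizer` of tabloids. -/
def Specht (lam : YoungDiagram) : Submodule (SymAlgebra lam) (SymAlgebra lam) :=
  Submodule.span (SymAlgebra lam) {colAntisymmetrizer lam * rowSymmetrizer lam}

instance (lam : YoungDiagram) : Module.Finite ℂ (Specht lam) :=
  Module.Finite.of_injective ((Specht lam).subtype.restrictScalars ℂ) (Specht lam).injective_subtype

/-- The Specht module as a representation of `𝔖_m`, acting by left multiplication. -/
def spechtRep (lam : YoungDiagram) :
    Representation ℂ (Equiv.Perm (Fin lam.card)) (Specht lam) :=
  (Algebra.lsmul ℂ ℂ (Specht lam)).toRingHom.toMonoidHom.comp (MonoidAlgebra.of ℂ _)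

/-- The representation `M_{λ¹} ⊠ ⋯ ⊠ M_{λⁿ}` of `𝔖_{|λ¹|} × ⋯ × 𝔖_{|λⁿ|}`. -/
def spechtBoxRep {n : ℕ} (lam : Fin n → YoungDiagram) :
    Representation ℂ (∀ i, Equiv.Perm (Fin (lam i).card)) (⨂[ℂ] i, Specht (lam i)) :=
  PiTensorProduct.mapMonoidHom.comp
    (MonoidHom.pi fun i => (spechtRep (lam i)).comp (Pi.evalMonoidHom _ i))

namespace UMod

open WeightedSet

variable {n : ℕ}

/-- A `𝒰`-module `M` with `M(T) = 0` whenever `|T| ≠ N` has finite support. -/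
theorem hasFiniteSupport_of_card {M : WeightedSet n ⥤ FGModuleCat.{0} ℂ} (N : ℕ)
    (h : ∀ T, Nontrivial (M.obj T) → Nat.card T.carrier = N) : HasFiniteSupport n M := by
  obtain ⟨s, hs, hs'⟩ := exists_finite_representatives (n := n) N
  exact ⟨s, hs, fun T hT => hs' T (h T hT)⟩

/-- The principal projective `P_a(T) = ℂ[Hom(a, T)]`. -/
def principalProjective (a : Fin n → ℕ) : UMod n where
  obj :=
    { obj T := FGModuleCat.of ℂ ((std a ⟶ T) →₀ ℂ)
      map ψ := FGModuleCat.ofHom (Finsupp.lmapDomain ℂ ℂ fun φ => φ ≫ ψ)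
      map_id T := by
        ext : 1
        change Finsupp.lmapDomain ℂ ℂ (fun φ : std a ⟶ T => φ ≫ 𝟙 T) = LinearMap.id
        simp only [Category.comp_id]
        exact Finsupp.lmapDomain_id ℂ ℂ
      map_comp {T T' T''} ψ χ := by
        ext : 1
        change Finsupp.lmapDomain ℂ ℂ (fun φ : std a ⟶ T => φ ≫ ψ ≫ χ) =
          Finsupp.lmapDomain ℂ ℂ (fun φ : std a ⟶ T' => φ ≫ χ) ∘ₗ
            Finsupp.lmapDomain ℂ ℂ (fun φ : std a ⟶ T => φ ≫ ψ)
        rw [← Finsupp.lmapDomain_comp]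
        rfl }
  property := hasFiniteSupport_of_card (Nat.card (std a).carrier) fun T hT => by
    by_contra h
    have : IsEmpty (std a ⟶ T) := ⟨fun φ => h (Nat.card_congr φ.toEquiv).symm⟩
    exact not_subsingleton ((std a ⟶ T) →₀ ℂ) inferInstance

/-- The principal injective `I_a(T) = ℂ[Hom(T, a)]^*`. -/
def principalInjective (a : Fin n → ℕ) : UMod n where
  obj :=
    { obj T := FGModuleCat.of ℂ (Module.Dual ℂ ((T ⟶ std a) →₀ ℂ))
      map ψ := FGModuleCat.ofHom (Finsupp.lmapDomain ℂ ℂ fun φ => ψ ≫ φ).dualMap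
      map_id T := by
        ext : 1
        change (Finsupp.lmapDomain ℂ ℂ fun φ : T ⟶ std a => 𝟙 T ≫ φ).dualMap = LinearMap.id
        simp only [Category.id_comp]
        exact (congrArg LinearMap.dualMap (Finsupp.lmapDomain_id ℂ ℂ)).trans LinearMap.dualMap_id
      map_comp {T T' T''} ψ χ := by
        ext : 1
        change (Finsupp.lmapDomain ℂ ℂ fun φ : T'' ⟶ std a => (ψ ≫ χ) ≫ φ).dualMap =
          (Finsupp.lmapDomain ℂ ℂ fun φ : T'' ⟶ std a => χ ≫ φ).dualMap ∘ₗ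
            (Finsupp.lmapDomain ℂ ℂ fun φ : T' ⟶ std a => ψ ≫ φ).dualMap
        rw [LinearMap.dualMap_comp_dualMap, ← Finsupp.lmapDomain_comp]
        rfl }
  property := hasFiniteSupport_of_card (Nat.card (std a).carrier) fun T hT => by
    by_contra h
    have : IsEmpty (T ⟶ std a) := ⟨fun φ => h (Nat.card_congr φ.toEquiv)⟩
    exact not_subsingleton (Module.Dual ℂ ((T ⟶ std a) →₀ ℂ)) inferInstance

/-- Equality of morphisms of `𝒰`-modules can be checked on each vector space. -/
theorem hom_ext' {M N : UMod n} {f g : M ⟶ N}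
    (h : ∀ T, (f.hom.app T).hom.hom = (g.hom.app T).hom.hom) : f = g := by
  ext T : 3
  exact FGModuleCat.hom_ext (h T)

/-- The action of `𝔖_a` on `P_a` by `𝒰`-module automorphisms: `g · [φ] = [φ ∘ g⁻¹]`. -/
def principalProjectiveAct (a : Fin n → ℕ) :
    (∀ i, Equiv.Perm (Fin (a i))) →* End (principalProjective a) where
  toFun g := ObjectProperty.homMk
    { app T := FGModuleCat.ofHom (Finsupp.lmapDomain ℂ ℂ fun φ : std a ⟶ T => stdAct a g⁻¹ ≫ φ)
      naturality T T' ψ := by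
        ext : 1
        change Finsupp.lmapDomain ℂ ℂ (fun φ : std a ⟶ T' => stdAct a g⁻¹ ≫ φ) ∘ₗ
            Finsupp.lmapDomain ℂ ℂ (fun φ : std a ⟶ T => φ ≫ ψ) =
          Finsupp.lmapDomain ℂ ℂ (fun φ : std a ⟶ T => φ ≫ ψ) ∘ₗ
            Finsupp.lmapDomain ℂ ℂ (fun φ : std a ⟶ T => stdAct a g⁻¹ ≫ φ)
        rw [← Finsupp.lmapDomain_comp, ← Finsupp.lmapDomain_comp]
        rfl }
  map_one' := hom_ext' fun T => Finsupp.lmapDomain_id ℂ ℂ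
  map_mul' g h := hom_ext' fun T => by
    change Finsupp.lmapDomain ℂ ℂ (fun φ : std a ⟶ T => stdAct a (g * h)⁻¹ ≫ φ) =
      Finsupp.lmapDomain ℂ ℂ (fun φ : std a ⟶ T => stdAct a g⁻¹ ≫ φ) ∘ₗ
        Finsupp.lmapDomain ℂ ℂ (fun φ : std a ⟶ T => stdAct a h⁻¹ ≫ φ)
    rw [← Finsupp.lmapDomain_comp, mul_inv_rev, stdAct_mul]
    rfl

/-- The action of `𝔖_a` on `I_a` by `𝒰`-module automorphisms: `(g · f)[φ] = f[g⁻¹ ∘ φ]`. -/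
def principalInjectiveAct (a : Fin n → ℕ) :
    (∀ i, Equiv.Perm (Fin (a i))) →* End (principalInjective a) where
  toFun g := ObjectProperty.homMk
    { app T := FGModuleCat.ofHom
        (Finsupp.lmapDomain ℂ ℂ fun φ : T ⟶ std a => φ ≫ stdAct a g⁻¹).dualMap
      naturality T T' ψ := by
        ext : 1
        change (Finsupp.lmapDomain ℂ ℂ fun φ : T' ⟶ std a => φ ≫ stdAct a g⁻¹).dualMap ∘ₗ
            (Finsupp.lmapDomain ℂ ℂ fun φ : T' ⟶ std a => ψ ≫ φ).dualMap =
          (Finsupp.lmapDomain ℂ ℂ fun φ : T' ⟶ std a => ψ ≫ φ).dualMap ∘ₗ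
            (Finsupp.lmapDomain ℂ ℂ fun φ : T ⟶ std a => φ ≫ stdAct a g⁻¹).dualMap
        rw [LinearMap.dualMap_comp_dualMap, LinearMap.dualMap_comp_dualMap,
          ← Finsupp.lmapDomain_comp, ← Finsupp.lmapDomain_comp]
        rfl }
  map_one' := hom_ext' fun T =>
    (congrArg LinearMap.dualMap (Finsupp.lmapDomain_id ℂ ℂ)).trans LinearMap.dualMap_id
  map_mul' g h := hom_ext' fun T => by
    change (Finsupp.lmapDomain ℂ ℂ fun φ : T ⟶ std a => φ ≫ stdAct a (g * h)⁻¹).dualMap =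
      (Finsupp.lmapDomain ℂ ℂ fun φ : T ⟶ std a => φ ≫ stdAct a g⁻¹).dualMap ∘ₗ
        (Finsupp.lmapDomain ℂ ℂ fun φ : T ⟶ std a => φ ≫ stdAct a h⁻¹).dualMap
    rw [LinearMap.dualMap_comp_dualMap, ← Finsupp.lmapDomain_comp, mul_inv_rev, stdAct_mul]
    rfl

section IsotypicPiece

variable {G V : Type} [Group G] [AddCommGroup V] [Module ℂ V] (ρ : Representation ℂ G V)
  (M : UMod n) (act : G →* End M)

/-- If `G` acts on the `𝒰`-module `M`, it acts on each vector space `M(T)`. -/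
def valueRep (T : WeightedSet n) : Representation ℂ G (M.obj.obj T) where
  toFun g := ((act g).hom.app T).hom.hom
  map_one' := by rw [map_one]; rfl
  map_mul' g h := by rw [map_mul]; rfl

theorem map_valueRep {T T' : WeightedSet n} (ψ : T ⟶ T') (g : G) :
    (M.obj.map ψ).hom.hom ∘ₗ valueRep M act T g =
      valueRep M act T' g ∘ₗ (M.obj.map ψ).hom.hom :=
  congrArg (fun f => f.hom.hom) ((act g).hom.naturality ψ).symm

/-- For `ψ : T ⟶ T'`, the map `M(T) → M(T')` is `G`-equivariant. -/
def mapIntertwining {T T' : WeightedSet n} (ψ : T ⟶ T') :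
    (valueRep M act T).IntertwiningMap (valueRep M act T') :=
  ⟨(M.obj.map ψ).hom.hom, map_valueRep M act ψ⟩

/-- The `𝒰`-module `T ↦ Hom_G(V, M(T))`, for a `𝒰`-module `M` on which `G` acts. -/
def isotypicPiece [Module.Finite ℂ V] : UMod n where
  obj :=
    { obj T := FGModuleCat.of ℂ (ρ.IntertwiningMap (valueRep M act T))
      map ψ := FGModuleCat.ofHom
        { toFun f := (mapIntertwining M act ψ).comp f
          map_add' _ _ := by ext; simp
          map_smul' _ _ := by ext; simp }
      map_id T := by
        ext f v
        change (M.obj.map (𝟙 T)).hom.hom (f v) = f v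
        rw [M.obj.map_id]
        rfl
      map_comp ψ χ := by
        ext f v
        change (M.obj.map (ψ ≫ χ)).hom.hom (f v) =
          (M.obj.map χ).hom.hom ((M.obj.map ψ).hom.hom (f v))
        rw [M.obj.map_comp]
        rfl }
  property := by
    obtain ⟨s, hs, hs'⟩ := M.property
    refine ⟨s, hs, fun T hT => hs' T ?_⟩
    by_contra h
    rw [not_nontrivial_iff_subsingleton] at h
    exact not_subsingleton (ρ.IntertwiningMap (valueRep M act T))
      ⟨fun f g => by ext v; exact Subsingleton.elim (α := M.obj.obj T) _ _⟩

end IsotypicPiece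

/-- The `𝒰`-module `P_λ = Hom_{𝔖_a}(M_λ, P_a)`, where `a = (|λ¹|, …, |λⁿ|)`. -/
def projectiveOf (lam : Fin n → YoungDiagram) : UMod n :=
  isotypicPiece (V := ⨂[ℂ] i, Specht (lam i)) (spechtBoxRep lam)
    (principalProjective fun i => (lam i).card)
    (principalProjectiveAct _)

/-- The `𝒰`-module `I_λ = Hom_{𝔖_a}(M_λ, I_a)`, where `a = (|λ¹|, …, |λⁿ|)`. -/
def injectiveOf (lam : Fin n → YoungDiagram) : UMod n :=
  isotypicPiece (V := ⨂[ℂ] i, Specht (lam i)) (spechtBoxRep lam)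
    (principalInjective fun i => (lam i).card)
    (principalInjectiveAct _)

end UMod

end

/-!
The Young symmetrizers give primitive idempotents of `ℂ[𝔖_a]`, one for each tuple of partitions,
and there are as many of them as conjugacy classes, so they generate `ℂ[𝔖_a]` as a two-sided ideal.
By Yoneda, `ℂ[𝔖_a]` is the endomorphism algebra of `P_a` and of `I_a`; hence `P_λ` and `I_λ` are
the retracts which these idempotents cut out, every `P_a` or `I_a` is a retract of a sum of them,
and all their endomorphisms are scalars. As an upwards bijection which is not an isomorphism raises
the total weight, nonzero morphisms between different members of either family change the total
weight in a fixed direction. Inductive arguments on the total weight show that a projective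
generated by the `P_λ` splits off one of maximal rank, and that killing a morphism `P_λ ⟶ M` of
maximal rank leaves a kernel of smaller rank, which bounds the projective dimension. The
injectives are treated in the opposite category.
-/

noncomputable section

/-! ### The group algebra of a finite group in characteristic zero -/

section GroupAlgebra

open MonoidAlgebra

/-- The element `e` of a `K`-algebra `A` has scalar corner if `e A e ⊆ K e`. In the group algebra of
a finite group, an idempotent with this property is primitive in a split block. -/
def HasScalarCorner (K : Type*) {A : Type*} [CommSemiring K] [Semiring A] [Algebra K A] (e : A) :
    Prop :=
  ∀ x, ∃ k : K, e * x * e = k • e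

theorem HasScalarCorner.smul {K A : Type*} [CommSemiring K] [Semiring A] [Algebra K A] {e : A}
    (he : HasScalarCorner K e) (c : K) : HasScalarCorner K (c • e) := fun x => by
  obtain ⟨k, hk⟩ := he x
  exact ⟨c * k, by simp only [smul_mul_assoc, mul_smul_comm, hk, mul_smul, smul_comm k c e]⟩

theorem HasScalarCorner.map {K A B : Type*} [CommSemiring K] [Semiring A] [Algebra K A] [Semiring B]
    [Algebra K B] {e : A} (he : HasScalarCorner K e) {φ : A →ₐ[K] B}
    (hφ : Function.Surjective φ) : HasScalarCorner K (φ e) := fun y => by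
  obtain ⟨x, rfl⟩ := hφ y
  obtain ⟨k, hk⟩ := he x
  exact ⟨k, by rw [← map_mul, ← map_mul, hk, map_smul]⟩

section Semiring

variable {K G : Type*} [CommSemiring K]

theorem mul_eq_mul_of_forall_of [Monoid G] {z : MonoidAlgebra K G}
    (h : ∀ g, of K G g * z = z * of K G g) (x : MonoidAlgebra K G) : x * z = z * x := by
  induction x using MonoidAlgebra.induction_on with
  | of g => exact h g
  | add x y hx hy => rw [add_mul, mul_add, hx, hy]
  | smul r x hx => rw [smul_mul_assoc, mul_smul_comm, hx]

theorem mul_mul_mem_of_forall_of [Monoid G] {W : Submodule K (MonoidAlgebra K G)}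
    {a b : MonoidAlgebra K G} (h : ∀ g, a * of K G g * b ∈ W) (x : MonoidAlgebra K G) :
    a * x * b ∈ W := by
  induction x using MonoidAlgebra.induction_on with
  | of g => exact h g
  | add x y hx hy => rw [mul_add, add_mul]; exact add_mem hx hy
  | smul r x hx => rw [mul_smul_comm, smul_mul_assoc]; exact W.smul_mem r hx

theorem coeff_eq_of_isConj [Group G] {z : MonoidAlgebra K G} (hz : ∀ x, x * z = z * x)
    {g h : G} (hgh : IsConj g h) : z.coeff g = z.coeff h := by
  obtain ⟨u, rfl⟩ := isConj_iff.1 hgh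
  have huz := congrArg (fun w => w.coeff (u * g)) (hz (of K G u))
  simpa only [of_apply, coeff_single_mul_apply, coeff_mul_single_apply, inv_mul_cancel_left,
    one_mul, mul_one] using huz

end Semiring

variable {K G : Type*} [Field K] [Group G]

theorem finrank_center_le [Finite G] :
    Module.finrank K (Subalgebra.center K (MonoidAlgebra K G)) ≤ Nat.card (ConjClasses G) := by
  cases nonempty_fintype (ConjClasses G)
  let values : Subalgebra.center K (MonoidAlgebra K G) →ₗ[K] (ConjClasses G → K) :=
    LinearMap.pi fun c => Finsupp.lapply c.out ∘ₗ (coeffLinearEquiv K).toLinearMap ∘ₗ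
      (Subalgebra.center K _).val.toLinearMap
  have values_injective : Function.Injective values := by
    rw [injective_iff_map_eq_zero]
    intro z hz
    ext g
    have hg : IsConj g (ConjClasses.mk g).out :=
      ConjClasses.mk_eq_mk_iff_isConj.1 (Quot.out_eq (ConjClasses.mk g)).symm
    rw [coeff_eq_of_isConj (fun x => Subalgebra.mem_center_iff.1 z.2 x) hg]
    exact congrFun hz (ConjClasses.mk g)
  simpa [Nat.card_eq_fintype_card] using LinearMap.finrank_le_finrank_of_injective values_injective

theorem linearIndependent_of_orthogonalIdempotents {A ι : Type*} [Ring A] [Algebra K A] {f : ι → A}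
    (hf : OrthogonalIdempotents f) (h0 : ∀ i, f i ≠ 0) : LinearIndependent K f := by
  classical
  rw [linearIndependent_iff']
  intro s c hc i hi
  have hci := congrArg (f i * ·) hc
  simp only [Finset.mul_sum, mul_smul_comm, hf.mul_eq, smul_ite, smul_zero, mul_zero,
    Finset.sum_ite_eq, hi, if_true] at hci
  exact (smul_eq_zero.1 hci).resolve_right (h0 i)

theorem orthogonalIdempotents_inv_smul {A ι : Type*} [Ring A] [Algebra K A] {z : ι → A}
    {k : ι → K} (hk0 : ∀ i, k i ≠ 0) (hk : ∀ i, z i * z i = k i • z i)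
    (hz : Pairwise fun i j => z i * z j = 0) : OrthogonalIdempotents fun i => (k i)⁻¹ • z i where
  idem i := by
    rw [IsIdempotentElem, smul_mul_smul_comm, hk, smul_smul, mul_assoc,
      inv_mul_cancel₀ (hk0 i), mul_one]
  ortho i j hij := (smul_mul_smul_comm ..).trans (by rw [hz hij, smul_zero])

theorem trace_lmul [Finite G] (x : MonoidAlgebra K G) :
    LinearMap.trace K _ (Algebra.lmul K _ x) = Nat.card G * x.coeff 1 := by
  classical
  cases nonempty_fintype G
  let b : Module.Basis G K (MonoidAlgebra K G) := .ofRepr (coeffLinearEquiv K)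
  have diag (g : G) : LinearMap.toMatrix b b (Algebra.lmul K _ x) g g = x.coeff 1 := by
    rw [LinearMap.toMatrix_apply]
    change (x * single g 1).coeff g = x.coeff 1
    rw [coeff_mul_single_apply, mul_inv_cancel, mul_one]
  simp only [LinearMap.trace_eq_matrix_trace K b, Matrix.trace, Matrix.diag, diag, Finset.sum_const,
    Finset.card_univ, nsmul_eq_mul, Nat.card_eq_fintype_card]

theorem sum_eq_one_of_finrank_center_le {A ι : Type*} [Ring A] [Algebra K A]
    [Module.Finite K (Subalgebra.center K A)] [Fintype ι] {f : ι → A}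
    (hf : OrthogonalIdempotents f) (h0 : ∀ i, f i ≠ 0) (hcenter : ∀ i, f i ∈ Subalgebra.center K A)
    (hcard : Module.finrank K (Subalgebra.center K A) ≤ Fintype.card ι) : ∑ i, f i = 1 := by
  by_contra hsum
  let f' : Option ι → A := fun o => o.elim (1 - ∑ i, f i) f
  have f'_orthogonal : OrthogonalIdempotents f' := (CompleteOrthogonalIdempotents.option hf).1
  have f'_ne_zero (o) : f' o ≠ 0 := by
    cases o with
    | none => exact sub_ne_zero.2 (Ne.symm hsum)
    | some i => exact h0 i
  have f'_mem_center (o) : f' o ∈ Subalgebra.center K A := by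
    cases o with
    | none => exact sub_mem (one_mem _) (sum_mem fun i _ => hcenter i)
    | some i => exact hcenter i
  have f'_independent :
      LinearIndependent K fun o => (⟨f' o, f'_mem_center o⟩ : Subalgebra.center K A) :=
    .of_comp (Subalgebra.center K A).val.toLinearMap
      (linearIndependent_of_orthogonalIdempotents f'_orthogonal f'_ne_zero)
  have := f'_independent.fintype_card_le_finrank
  rw [Fintype.card_option] at this
  omega

section CharZero

variable [CharZero K]

theorem coeff_one_eq_zero_of_isNilpotent [Finite G] {x : MonoidAlgebra K G} (hx : IsNilpotent x) :
    x.coeff 1 = 0 := by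
  have trace_eq_zero : LinearMap.trace K _ (Algebra.lmul K _ x) = 0 :=
    (LinearMap.isNilpotent_trace_of_isNilpotent (hx.map (Algebra.lmul K _))).eq_zero
  rw [trace_lmul] at trace_eq_zero
  exact (mul_eq_zero.1 trace_eq_zero).resolve_left (Nat.cast_ne_zero.2 Nat.card_pos.ne')

theorem eq_zero_of_forall_mul_mul_self_eq_zero [Finite G] {z : MonoidAlgebra K G}
    (hz : ∀ x, z * x * z = 0) : z = 0 := by
  ext g
  have nilpotent : IsNilpotent (of K G g⁻¹ * z) := ⟨2, by
    rw [pow_two, mul_assoc, ← mul_assoc z, hz, mul_zero]⟩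
  simpa only [of_apply, coeff_single_mul_apply, inv_inv, mul_one, one_mul] using!
    coeff_one_eq_zero_of_isNilpotent nilpotent

theorem forall_mul_mul_eq_zero_symm [Finite G] {a b : MonoidAlgebra K G}
    (h : ∀ x, a * x * b = 0) (x : MonoidAlgebra K G) : b * x * a = 0 :=
  eq_zero_of_forall_mul_mul_self_eq_zero fun y => by
    rw [show b * x * a * y * (b * x * a) = b * x * (a * y * b) * x * a by simp only [mul_assoc], h,
      mul_zero, zero_mul, zero_mul]

theorem ne_zero_of_mul_self_eq_smul [Finite G] {x : MonoidAlgebra K G} {k : K}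
    (hx : x * x = k • x) (h1 : x.coeff 1 ≠ 0) : k ≠ 0 := by
  rintro rfl
  exact h1 (coeff_one_eq_zero_of_isNilpotent ⟨2, by rw [pow_two, hx, zero_smul]⟩)

theorem HasScalarCorner.exists_mul_self [Finite G] {e : MonoidAlgebra K G}
    (he : HasScalarCorner K e) (h1 : e.coeff 1 ≠ 0) : ∃ k : K, k ≠ 0 ∧ e * e = k • e := by
  obtain ⟨k, hk⟩ := he 1
  rw [mul_one] at hk
  exact ⟨k, ne_zero_of_mul_self_eq_smul hk h1, hk⟩

end CharZero

section ConjugateSum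

variable [Fintype G]

/-- The sum of the conjugates of an element of the group algebra; up to a scalar it is the
projection onto the centre. -/
def conjugateSum (e : MonoidAlgebra K G) : MonoidAlgebra K G :=
  ∑ g, of K G g * e * of K G g⁻¹

theorem mul_conjugateSum (e x : MonoidAlgebra K G) : x * conjugateSum e = conjugateSum e * x := by
  refine mul_eq_mul_of_forall_of (fun u => ?_) x
  rw [conjugateSum, Finset.mul_sum, Finset.sum_mul]
  refine Fintype.sum_equiv (Equiv.mulLeft u) _ _ fun g => ?_
  simp only [Equiv.coe_mulLeft, map_mul, mul_inv_rev, mul_assoc]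
  rw [← map_mul _ u⁻¹, inv_mul_cancel, map_one, mul_one]

theorem coeff_one_conjugateSum (e : MonoidAlgebra K G) :
    (conjugateSum e).coeff 1 = Fintype.card G * e.coeff 1 := by
  simp [conjugateSum, Finsupp.finsetSum_apply]

theorem conjugateSum_mul_conjugateSum_eq_zero {e f : MonoidAlgebra K G}
    (h : ∀ x, e * x * f = 0) : conjugateSum e * conjugateSum f = 0 := by
  rw [conjugateSum, Finset.sum_mul]
  refine Finset.sum_eq_zero fun g _ => ?_
  rw [mul_assoc, mul_conjugateSum, conjugateSum, Finset.sum_mul, Finset.mul_sum]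
  refine Finset.sum_eq_zero fun u _ => ?_
  rw [show of K G g * e * (of K G u * f * of K G u⁻¹ * of K G g⁻¹) =
    of K G g * (e * of K G u * f) * (of K G u⁻¹ * of K G g⁻¹) by simp only [mul_assoc], h,
    mul_zero, zero_mul]

variable [CharZero K]

theorem HasScalarCorner.exists_conjugateSum_mul {e : MonoidAlgebra K G} (he : HasScalarCorner K e)
    (h1 : e.coeff 1 ≠ 0) : ∃ k : K, conjugateSum e * e = k • e := by
  obtain ⟨k, hk0, hk⟩ := he.exists_mul_self h1
  obtain ⟨l, hl⟩ := he (conjugateSum e)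
  refine ⟨k⁻¹ * l, ?_⟩
  rw [mul_conjugateSum, mul_assoc, hk, mul_smul_comm] at hl
  rw [mul_smul, ← hl, inv_smul_smul₀ hk0]

theorem HasScalarCorner.exists_conjugateSum_mul_self {e : MonoidAlgebra K G}
    (he : HasScalarCorner K e) (h1 : e.coeff 1 ≠ 0) :
    ∃ k : K, k ≠ 0 ∧ conjugateSum e * conjugateSum e = k • conjugateSum e := by
  obtain ⟨k, hk⟩ := he.exists_conjugateSum_mul h1
  have key : conjugateSum e * conjugateSum e = k • conjugateSum e := by
    conv_lhs => rhs; rw [conjugateSum]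
    conv_rhs => rw [conjugateSum]
    rw [Finset.mul_sum, Finset.smul_sum]
    refine Finset.sum_congr rfl fun g _ => ?_
    rw [← mul_assoc, ← mul_assoc, ← mul_conjugateSum, mul_assoc (of K G g), hk, mul_smul_comm,
      smul_mul_assoc]
  refine ⟨k, ne_zero_of_mul_self_eq_smul key ?_, key⟩
  rw [coeff_one_conjugateSum]
  exact mul_ne_zero (Nat.cast_ne_zero.2 Fintype.card_ne_zero) h1

end ConjugateSum

theorem one_mem_span_mul_mul [CharZero K] [Finite G] {ι : Type*} [Finite ι]
    {e : ι → MonoidAlgebra K G} (he : ∀ i, HasScalarCorner K (e i)) (h1 : ∀ i, (e i).coeff 1 ≠ 0)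
    (horth : Pairwise fun i j => ∀ x, e i * x * e j = 0)
    (hcard : Nat.card (ConjClasses G) ≤ Nat.card ι) :
    1 ∈ Submodule.span K {z | ∃ i x y, z = x * e i * y} := by
  cases nonempty_fintype G
  cases nonempty_fintype ι
  choose k hk0 hk using fun i => (he i).exists_conjugateSum_mul_self (h1 i)
  have sum_eq_one : ∑ i, (k i)⁻¹ • conjugateSum (e i) = 1 := by
    refine sum_eq_one_of_finrank_center_le (K := K)
      (orthogonalIdempotents_inv_smul hk0 hk fun i j hij =>
        conjugateSum_mul_conjugateSum_eq_zero (horth hij))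
      (fun i h => ?_) (fun i => ?_)
      (finrank_center_le.trans (hcard.trans_eq Nat.card_eq_fintype_card))
    · have := coeff_one_conjugateSum (e i)
      rw [(smul_eq_zero.1 h).resolve_left (inv_ne_zero (hk0 i))] at this
      exact mul_ne_zero (Nat.cast_ne_zero.2 Fintype.card_ne_zero) (h1 i) this.symm
    · exact Subalgebra.smul_mem _ (Subalgebra.mem_center_iff.2 (mul_conjugateSum (e i))) _
  rw [← sum_eq_one]
  exact sum_mem fun i _ => Submodule.smul_mem _ _ <| sum_mem fun g _ =>
    Submodule.subset_span ⟨i, _, _, rfl⟩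

end GroupAlgebra

/-! ### Fillings of Young diagrams -/

/-- A numbering of the boxes of the Young diagram `lam` by a type `α`, i.e. a tableau of shape
`lam`. The label type is a variable, so that diagrams of equal size can share their labels. -/
abbrev Filling (lam : YoungDiagram) (α : Type*) := α ≃ lam.cells

namespace Filling

variable {lam mu : YoungDiagram} {α : Type*}

/-- The row of the box with a given label. -/
def row (t : Filling lam α) (x : α) : ℕ := (t x).1.1

/-- The column of the box with a given label. -/
def col (t : Filling lam α) (x : α) : ℕ := (t x).1.2

theorem row_col_injective (t : Filling lam α) : Function.Injective fun x => (t.row x, t.col x) :=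
  Subtype.val_injective.comp t.injective

variable [Fintype α]

theorem cells_eq_map (t : Filling lam α) :
    lam.cells = Finset.univ.map ⟨_, t.row_col_injective⟩ := by
  ext c
  simp only [Finset.mem_map, Finset.mem_univ, true_and]
  exact ⟨fun hc => ⟨t.symm ⟨c, hc⟩, congrArg Subtype.val (t.apply_symm_apply _)⟩,
    by rintro ⟨x, rfl⟩; exact (t x).2⟩

theorem rowLen_eq_card (t : Filling lam α) (i : ℕ) :
    lam.rowLen i = Finset.card {x | t.row x = i} := by
  rw [YoungDiagram.rowLen_eq_card, YoungDiagram.row, t.cells_eq_map, Finset.filter_map,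
    Finset.card_map]
  rfl

theorem mem_cells_of_sum_le (t : Filling lam α) {r : α → ℕ}
    (hr : Function.Injective fun x => (r x, t.col x)) (h : ∑ x, r x ≤ ∑ x, t.row x) (x : α) :
    (r x, t.col x) ∈ lam.cells := by
  -- This statistic is negative exactly on the boxes of the diagram, so that among the sets of
  -- `lam.card` boxes the diagram is the only one of minimal sum.
  let excess (c : ℕ × ℕ) : ℤ := c.1 - lam.colLen c.2
  have excess_neg (c : ℕ × ℕ) : excess c < 0 ↔ c ∈ lam.cells := by
    rw [sub_neg, Nat.cast_lt, YoungDiagram.mem_cells]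
    exact YoungDiagram.mem_iff_lt_colLen.symm
  let image : Finset (ℕ × ℕ) := Finset.univ.map ⟨_, hr⟩
  have sum_le : ∑ c ∈ image, excess c ≤ ∑ c ∈ lam.cells, excess c := by
    rw [t.cells_eq_map, Finset.sum_map, Finset.sum_map]
    simp only [excess, Function.Embedding.coeFn_mk, Finset.sum_sub_distrib]
    exact sub_le_sub_right (by exact_mod_cast h) _
  have subset : lam.cells ⊆ image := by
    by_contra hsub
    have neg : ∑ c ∈ lam.cells \ image, excess c < 0 :=
      Finset.sum_neg (fun c hc => (excess_neg c).2 (Finset.mem_sdiff.1 hc).1)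
        (Finset.sdiff_nonempty.2 hsub)
    have nonneg : 0 ≤ ∑ c ∈ image \ lam.cells, excess c :=
      Finset.sum_nonneg fun c hc => not_lt.1 fun hlt =>
        (Finset.mem_sdiff.1 hc).2 ((excess_neg c).1 hlt)
    exact absurd (Finset.sum_sdiff_lt_sum_sdiff.1 (neg.trans_le nonneg)) sum_le.not_gt
  have image_eq : lam.cells = image :=
    Finset.eq_of_subset_of_card_le subset (by rw [t.cells_eq_map, Finset.card_map, Finset.card_map])
  exact image_eq ▸ Finset.mem_map_of_mem ⟨_, hr⟩ (Finset.mem_univ x)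

theorem exists_row_apply_eq (t : Filling lam α) {r : α → ℕ}
    (hr : Function.Injective fun x => (r x, t.col x)) (h : ∑ x, r x ≤ ∑ x, t.row x) :
    ∃ σ : Equiv.Perm α, (∀ x, t.col (σ x) = t.col x) ∧ ∀ x, t.row (σ x) = r x := by
  let move (x : α) : lam.cells := ⟨(r x, t.col x), t.mem_cells_of_sum_le hr h x⟩
  have move_injective : Function.Injective (t.symm ∘ move) :=
    t.symm.injective.comp fun x y hxy => hr (congrArg Subtype.val hxy)
  refine ⟨.ofBijective _ (Finite.injective_iff_bijective.1 move_injective),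
    fun x => ?_, fun x => ?_⟩
  · exact congrArg (fun c => c.1.2) (t.apply_symm_apply (move x))
  · exact congrArg (fun c => c.1.1) (t.apply_symm_apply (move x))

theorem shape_eq_of_injective (t : Filling lam α) (s : Filling mu α)
    (hr : Function.Injective fun x => (s.row x, t.col x)) (h : ∑ x, s.row x ≤ ∑ x, t.row x) :
    lam = mu := by
  obtain ⟨σ, -, hσ⟩ := t.exists_row_apply_eq hr h
  have rowLen_eq (i : ℕ) : lam.rowLen i = mu.rowLen i := by
    rw [t.rowLen_eq_card, s.rowLen_eq_card]
    refine (Finset.card_equiv σ fun x => ?_).symm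
    simp only [Finset.mem_filter, Finset.mem_univ, true_and, hσ]
  ext ⟨i, j⟩
  simp only [YoungDiagram.mem_cells, YoungDiagram.mem_iff_lt_rowLen, rowLen_eq]

end Filling

/-! ### Young symmetrizers -/

section CharacterSum

open MonoidAlgebra

/-- The element `∑ χ(h) h`, over a subgroup `H`, of a group algebra. Row symmetrizers and column
antisymmetrizers of tableaux are of this form. -/
def characterSum {K G : Type*} [Semiring K] [Group G] [Fintype G] (H : Subgroup G) (χ : G →* K) :
    MonoidAlgebra K G :=
  open Classical in ∑ g with g ∈ H, χ g • of K G g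

variable {K G : Type*} [CommRing K] [Group G] [Fintype G] {H L : Subgroup G} {χ ψ : G →* K}

open Classical in
theorem coeff_characterSum (g : G) : (characterSum H χ).coeff g = if g ∈ H then χ g else 0 := by
  simp [characterSum, Finsupp.finsetSum_apply, Finsupp.single_apply]

open Classical in
theorem of_mul_characterSum {h : G} (hh : h ∈ H) :
    of K G h * characterSum H χ = χ h⁻¹ • characterSum H χ := by
  ext g
  rw [of_apply, coeff_single_mul_apply, one_mul, coeff_smul_apply, coeff_characterSum,
    coeff_characterSum, smul_eq_mul, mul_ite, mul_zero, map_mul]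
  exact if_congr (H.mul_mem_cancel_left (H.inv_mem hh)) rfl rfl

open Classical in
theorem characterSum_mul_of {h : G} (hh : h ∈ H) :
    characterSum H χ * of K G h = χ h⁻¹ • characterSum H χ := by
  ext g
  rw [of_apply, coeff_mul_single_apply, mul_one, coeff_smul_apply, coeff_characterSum,
    coeff_characterSum, smul_eq_mul, mul_ite, mul_zero, map_mul, mul_comm (χ g)]
  exact if_congr (H.mul_mem_cancel_right (H.inv_mem hh)) rfl rfl

theorem characterSum_mul_of_mul_characterSum_eq_zero [IsDomain K] {g h l : G} (hh : h ∈ H)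
    (hl : l ∈ L) (hgl : h * g = g * l) (hne : χ h⁻¹ ≠ ψ l⁻¹) :
    characterSum H χ * of K G g * characterSum L ψ = 0 := by
  have key : χ h⁻¹ • (characterSum H χ * of K G g * characterSum L ψ) =
      ψ l⁻¹ • (characterSum H χ * of K G g * characterSum L ψ) := by
    rw [← smul_mul_assoc, ← smul_mul_assoc, ← characterSum_mul_of hh, mul_assoc (characterSum H χ),
      ← map_mul, hgl, map_mul, mul_assoc, mul_assoc, of_mul_characterSum hl, mul_smul_comm,
      mul_smul_comm, mul_assoc]
  exact (smul_eq_zero.1 ((sub_smul _ _ _).trans (sub_eq_zero.2 key))).resolve_left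
    (sub_ne_zero.2 hne)

theorem coeff_one_characterSum_mul_characterSum (h : H ⊓ L = ⊥) :
    (characterSum H χ * characterSum L ψ).coeff 1 = 1 := by
  rw [coeff_mul_apply_left, Finsupp.sum_fintype _ _ fun _ => zero_mul _, Finset.sum_eq_single 1]
  · simp [coeff_characterSum]
  · intro g _ hg
    by_cases hL : g ∈ L
    · have hH : g ∉ H := fun hH => hg (Subgroup.mem_bot.1 (h ▸ ⟨hH, hL⟩))
      rw [coeff_characterSum, if_neg hH, zero_mul]
    · rw [mul_one, coeff_characterSum (H := L), if_neg (mt L.inv_mem_iff.1 hL), mul_zero]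
  · simp

end CharacterSum

section Stabilizer

/-- The permutations of `α` preserving each fibre of `f`. For the row and column functions of a
filling, these are its row and column stabilizers. -/
def fiberStabilizer {α β : Type*} (f : α → β) : Subgroup (Equiv.Perm α) where
  carrier := {σ | ∀ x, f (σ x) = f x}
  one_mem' _ := rfl
  mul_mem' hσ hτ x := (hσ _).trans (hτ x)
  inv_mem' {σ} hσ x := (hσ (σ⁻¹ x)).symm.trans (congrArg f (σ.apply_symm_apply x))

theorem swap_mem_fiberStabilizer {α β : Type*} [DecidableEq α] {f : α → β} {x y : α}
    (h : f x = f y) : Equiv.swap x y ∈ fiberStabilizer f := fun z => by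
  rcases eq_or_ne z x with rfl | hx
  · rw [Equiv.swap_apply_left, h]
  rcases eq_or_ne z y with rfl | hy
  · rw [Equiv.swap_apply_right, h]
  rw [Equiv.swap_apply_of_ne_of_ne hx hy]

/-- The sign of a permutation, as a character with values in `K`. -/
def signCharacter (K α : Type*) [CommRing K] [Fintype α] [DecidableEq α] : Equiv.Perm α →* K :=
  (Int.castRingHom K : ℤ →* K).comp ((Units.coeHom ℤ).comp Equiv.Perm.sign)

end Stabilizer

namespace Filling

open MonoidAlgebra

variable {lam mu : YoungDiagram} {α : Type*} (K : Type*)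

theorem fiberStabilizer_col_inf_fiberStabilizer_row (t : Filling lam α) :
    fiberStabilizer t.col ⊓ fiberStabilizer t.row = ⊥ :=
  (Subgroup.eq_bot_iff_forall _).2 fun _ hσ => Equiv.ext fun x =>
    t.row_col_injective (Prod.ext (hσ.2 x) (hσ.1 x))

variable [Fintype α] [DecidableEq α]

section CommRing

variable [CommRing K]

/-- The sum of the row stabilizer of a filling. -/
def rowSymmetrizer (t : Filling lam α) : MonoidAlgebra K (Equiv.Perm α) :=
  characterSum (fiberStabilizer t.row) 1

/-- The signed sum of the column stabilizer of a filling. -/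
def colAntisymmetrizer (t : Filling lam α) : MonoidAlgebra K (Equiv.Perm α) :=
  characterSum (fiberStabilizer t.col) (signCharacter K α)

/-- The Young symmetrizer of a filling, with the factors ordered as in `Specht`. -/
def youngSymmetrizer (t : Filling lam α) : MonoidAlgebra K (Equiv.Perm α) :=
  t.colAntisymmetrizer K * t.rowSymmetrizer K

theorem coeff_one_youngSymmetrizer (t : Filling lam α) : (t.youngSymmetrizer K).coeff 1 = 1 :=
  coeff_one_characterSum_mul_characterSum t.fiberStabilizer_col_inf_fiberStabilizer_row

end CommRing

variable {K} [Field K] [CharZero K]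

theorem injective_of_colAntisymmetrizer_mul_of_mul_rowSymmetrizer_ne_zero (t : Filling lam α)
    (s : Filling mu α) {g : Equiv.Perm α}
    (h : t.colAntisymmetrizer K * of K _ g * s.rowSymmetrizer K ≠ 0) :
    Function.Injective fun x => (s.row (g⁻¹ x), t.col x) := by
  intro x y hxy
  obtain ⟨hrow, hcol⟩ := Prod.ext_iff.1 hxy
  by_contra hne
  refine h (characterSum_mul_of_mul_characterSum_eq_zero
    (swap_mem_fiberStabilizer hcol)
    (swap_mem_fiberStabilizer hrow) (Equiv.swap_mul_eq_mul_swap g x y) ?_)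
  have sign_swap : signCharacter K α (Equiv.swap x y)⁻¹ = -1 := by
    simp [signCharacter, Equiv.Perm.sign_swap hne]
  rw [sign_swap, MonoidHom.one_apply]
  exact neg_ne_self.2 one_ne_zero

theorem colAntisymmetrizer_mul_mul_rowSymmetrizer_mem_span (t : Filling lam α)
    (x : MonoidAlgebra K (Equiv.Perm α)) :
    t.colAntisymmetrizer K * x * t.rowSymmetrizer K ∈ K ∙ t.youngSymmetrizer K := by
  refine mul_mul_mem_of_forall_of (fun g => ?_) x
  by_cases h : t.colAntisymmetrizer K * of K _ g * t.rowSymmetrizer K = 0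
  · exact h ▸ zero_mem _
  obtain ⟨σ, hcol, hrow⟩ := t.exists_row_apply_eq
    (t.injective_of_colAntisymmetrizer_mul_of_mul_rowSymmetrizer_ne_zero t h)
    (Equiv.sum_comp g⁻¹ t.row).le
  replace hcol : σ ∈ fiberStabilizer t.col := hcol
  have hrow' : σ * g ∈ fiberStabilizer t.row := fun x =>
    (hrow (g x)).trans (congrArg t.row (g.symm_apply_apply x))
  have factor : of K (Equiv.Perm α) g = of K _ σ⁻¹ * of K _ (σ * g) := by
    rw [← map_mul, inv_mul_cancel_left]
  rw [factor, ← mul_assoc, mul_assoc, colAntisymmetrizer, rowSymmetrizer,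
    characterSum_mul_of (inv_mem hcol), of_mul_characterSum hrow', smul_mul_smul_comm]
  exact Submodule.smul_mem _ _ (Submodule.mem_span_singleton_self _)

theorem hasScalarCorner_youngSymmetrizer (t : Filling lam α) :
    HasScalarCorner K (t.youngSymmetrizer K) := fun x => by
  obtain ⟨k, hk⟩ := Submodule.mem_span_singleton.1
    (t.colAntisymmetrizer_mul_mul_rowSymmetrizer_mem_span
      (t.rowSymmetrizer K * x * t.colAntisymmetrizer K))
  exact ⟨k, by rw [hk]; simp only [youngSymmetrizer, mul_assoc]⟩

theorem youngSymmetrizer_mul_mul_eq_zero_of_le (t : Filling lam α) (s : Filling mu α)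
    (hne : lam ≠ mu) (hle : ∑ x, s.row x ≤ ∑ x, t.row x) (x : MonoidAlgebra K (Equiv.Perm α)) :
    t.youngSymmetrizer K * x * s.youngSymmetrizer K = 0 := by
  have key (y : MonoidAlgebra K (Equiv.Perm α)) :
      t.colAntisymmetrizer K * y * s.rowSymmetrizer K ∈ (⊥ : Submodule K _) := by
    refine mul_mul_mem_of_forall_of (fun g => ?_) y
    by_contra h
    exact hne (t.shape_eq_of_injective (g⁻¹.trans s)
      (t.injective_of_colAntisymmetrizer_mul_of_mul_rowSymmetrizer_ne_zero s h)
      ((Equiv.sum_comp g⁻¹ s.row).trans_le hle))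
  refine Eq.trans ?_ ((Submodule.mem_bot K).1
    (key (t.rowSymmetrizer K * x * s.colAntisymmetrizer K)))
  simp only [youngSymmetrizer, mul_assoc]

theorem youngSymmetrizer_mul_mul_eq_zero (t : Filling lam α) (s : Filling mu α) (hne : lam ≠ mu)
    (x : MonoidAlgebra K (Equiv.Perm α)) :
    t.youngSymmetrizer K * x * s.youngSymmetrizer K = 0 := by
  rcases le_total (∑ x, s.row x) (∑ x, t.row x) with hle | hle
  · exact t.youngSymmetrizer_mul_mul_eq_zero_of_le s hne hle x
  · exact forall_mul_mul_eq_zero_symm (s.youngSymmetrizer_mul_mul_eq_zero_of_le t hne.symm hle) x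

variable (K) in
/-- The scalar `k` with `c * c = k • c`, where `c` is the Young symmetrizer. -/
def youngScalar (t : Filling lam α) : K := (t.youngSymmetrizer K * t.youngSymmetrizer K).coeff 1

theorem youngSymmetrizer_mul_self (t : Filling lam α) :
    t.youngSymmetrizer K * t.youngSymmetrizer K = t.youngScalar K • t.youngSymmetrizer K := by
  obtain ⟨k, hk⟩ := t.hasScalarCorner_youngSymmetrizer (K := K) 1
  rw [mul_one] at hk
  rw [youngScalar, hk, coeff_smul_apply, coeff_one_youngSymmetrizer, smul_eq_mul, mul_one]

theorem youngScalar_ne_zero (t : Filling lam α) : t.youngScalar K ≠ 0 :=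
  ne_zero_of_mul_self_eq_smul t.youngSymmetrizer_mul_self
    ((t.coeff_one_youngSymmetrizer K).symm ▸ one_ne_zero)

variable (K) in
/-- The primitive idempotent proportional to the Young symmetrizer. -/
def youngIdempotent (t : Filling lam α) : MonoidAlgebra K (Equiv.Perm α) :=
  (t.youngScalar K)⁻¹ • t.youngSymmetrizer K

theorem youngSymmetrizer_mul_youngIdempotent (t : Filling lam α) :
    t.youngSymmetrizer K * t.youngIdempotent K = t.youngSymmetrizer K := by
  rw [youngIdempotent, mul_smul_comm, youngSymmetrizer_mul_self,
    inv_smul_smul₀ t.youngScalar_ne_zero]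

theorem hasScalarCorner_youngIdempotent (t : Filling lam α) :
    HasScalarCorner K (t.youngIdempotent K) :=
  HasScalarCorner.smul t.hasScalarCorner_youngSymmetrizer _

theorem youngIdempotent_mul_mul_eq_zero (t : Filling lam α) (s : Filling mu α) (hne : lam ≠ mu)
    (x : MonoidAlgebra K (Equiv.Perm α)) : t.youngIdempotent K * x * s.youngIdempotent K = 0 := by
  rw [youngIdempotent, youngIdempotent, smul_mul_assoc, smul_mul_smul_comm,
    t.youngSymmetrizer_mul_mul_eq_zero s hne, smul_zero]

theorem coeff_one_youngIdempotent_ne_zero (t : Filling lam α) :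
    (t.youngIdempotent K).coeff 1 ≠ 0 := by
  rw [youngIdempotent, coeff_smul_apply, coeff_one_youngSymmetrizer, smul_eq_mul, mul_one]
  exact inv_ne_zero t.youngScalar_ne_zero

end Filling

/-! ### Products of symmetric groups -/

section CycleDiagram

/-- The Young diagram whose rows are the cycle lengths of a permutation, fixed points included. -/
def cycleDiagram {α : Type*} [Fintype α] [DecidableEq α] (σ : Equiv.Perm α) : YoungDiagram :=
  .ofRowLens (σ.partition.parts.sort (· ≥ ·))
    (List.sortedGE_iff_pairwise.2 (σ.partition.parts.pairwise_sort _))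

theorem card_ofRowLens (w : List ℕ) (hw : w.SortedGE) :
    (YoungDiagram.ofRowLens w hw).card = w.sum := by
  have card_cellsOfRowLens (w : List ℕ) : (YoungDiagram.cellsOfRowLens w).card = w.sum := by
    induction w with
    | nil => rfl
    | cons a w ih =>
      rw [YoungDiagram.cellsOfRowLens, Finset.card_union_of_disjoint, Finset.card_map, ih]
      · simp
      · rw [Finset.disjoint_left]
        rintro ⟨i, j⟩ h1 h2
        simp only [Finset.mem_product, Finset.mem_singleton, Finset.mem_map] at h1 h2
        obtain ⟨c, -, hc⟩ := h2
        have := congrArg Prod.fst hc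
        simp [h1.1] at this
  exact card_cellsOfRowLens w

variable {α : Type*} [Fintype α] [DecidableEq α]

theorem card_cycleDiagram (σ : Equiv.Perm α) : (cycleDiagram σ).card = Fintype.card α := by
  rw [cycleDiagram, card_ofRowLens, ← Multiset.sum_coe, Multiset.sort_eq, σ.partition.parts_sum]

theorem coe_rowLens_cycleDiagram (σ : Equiv.Perm α) :
    ((cycleDiagram σ).rowLens : Multiset ℕ) = σ.partition.parts := by
  rw [cycleDiagram, YoungDiagram.rowLens_ofRowLens_eq_self fun x hx =>
    σ.partition.parts_pos ((Multiset.mem_sort _).1 hx), Multiset.sort_eq]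

theorem isConj_of_cycleDiagram_eq {σ τ : Equiv.Perm α} (h : cycleDiagram σ = cycleDiagram τ) :
    IsConj σ τ :=
  Equiv.Perm.partition_eq_of_isConj.2 <| Nat.Partition.ext <| by
    rw [← coe_rowLens_cycleDiagram, h, coe_rowLens_cycleDiagram]

theorem isConj_of_forall_cycleDiagram_eq {ι : Type*} {α : ι → Type*} [∀ i, Fintype (α i)]
    [∀ i, DecidableEq (α i)] {σ τ : ∀ i, Equiv.Perm (α i)}
    (h : ∀ i, cycleDiagram (σ i) = cycleDiagram (τ i)) : IsConj σ τ := by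
  choose u hu using fun i => isConj_iff.1 (isConj_of_cycleDiagram_eq (h i))
  exact isConj_iff.2 ⟨u, funext hu⟩

end CycleDiagram

section BoxProd

open MonoidAlgebra

theorem coeff_mul_eq_sum {K G : Type*} [Semiring K] [Group G] [Fintype G] (x y : MonoidAlgebra K G)
    (g : G) : (x * y).coeff g = ∑ h, x.coeff h * y.coeff (h⁻¹ * g) := by
  rw [coeff_mul_apply_left, Finsupp.sum_fintype _ _ fun _ => zero_mul _]

variable {ι K : Type*} [Fintype ι] [CommSemiring K] {H : ι → Type*}

/-- The external product of elements of group algebras, as an element of the group algebra of the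
product group. -/
def boxProd [∀ i, Finite (H i)] :
    MultilinearMap K (fun i => MonoidAlgebra K (H i)) (MonoidAlgebra K (∀ i, H i)) :=
  ((coeffLinearEquiv K).symm.toLinearMap ∘ₗ
    (Finsupp.linearEquivFunOnFinite K K (∀ i, H i)).symm.toLinearMap).compMultilinearMap
    (MultilinearMap.pi fun g => (MultilinearMap.mkPiAlgebra K ι K).compLinearMap fun i =>
      Finsupp.lapply (g i) ∘ₗ (coeffLinearEquiv K).toLinearMap)

theorem coeff_boxProd [∀ i, Finite (H i)] (x : ∀ i, MonoidAlgebra K (H i)) (g : ∀ i, H i) :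
    (boxProd x).coeff g = ∏ i, (x i).coeff (g i) := rfl

variable [∀ i, Group (H i)]

variable [∀ i, Finite (H i)]

theorem boxProd_mul (x y : ∀ i, MonoidAlgebra K (H i)) :
    boxProd x * boxProd y = boxProd (x * y) := by
  classical
  have (i : ι) : Fintype (H i) := .ofFinite _
  ext g
  rw [coeff_mul_eq_sum, coeff_boxProd]
  simp only [coeff_boxProd, Pi.mul_apply, coeff_mul_eq_sum, Finset.prod_univ_sum,
    Fintype.piFinset_univ, Finset.prod_mul_distrib, Pi.inv_apply]

theorem boxProd_of (g : ∀ i, H i) : boxProd (fun i => of K (H i) (g i)) = of K _ g := by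
  classical
  ext h
  simp only [coeff_boxProd, of_apply, coeff_single, Finsupp.single_apply, Finset.prod_ite_zero,
    Finset.mem_univ, forall_const, Finset.prod_const_one, funext_iff]

theorem HasScalarCorner.boxProd {e : ∀ i, MonoidAlgebra K (H i)}
    (he : ∀ i, HasScalarCorner K (e i)) : HasScalarCorner K (boxProd e) := fun x => by
  have key : _root_.boxProd e * x * _root_.boxProd e ∈ K ∙ _root_.boxProd e := by
    refine mul_mul_mem_of_forall_of (fun g => ?_) x
    choose k hk using fun i => he i (of K _ (g i))
    rw [← boxProd_of, boxProd_mul, boxProd_mul]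
    exact Submodule.mem_span_singleton.2 ⟨∏ i, k i,
      (MultilinearMap.map_smul_univ ..).symm.trans (congrArg _ (funext hk).symm)⟩
  obtain ⟨k, hk⟩ := Submodule.mem_span_singleton.1 key
  exact ⟨k, hk.symm⟩

theorem boxProd_mul_mul_eq_zero {e f : ∀ i, MonoidAlgebra K (H i)} {i : ι}
    (h : ∀ x, e i * x * f i = 0) (x : MonoidAlgebra K (∀ i, H i)) :
    boxProd e * x * boxProd f = 0 := by
  refine (Submodule.mem_bot K).1 (mul_mul_mem_of_forall_of (fun g => ?_) x)
  rw [← boxProd_of, boxProd_mul, boxProd_mul]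
  exact boxProd.map_coord_zero i (h _)

end BoxProd

section BoxIdempotent

open MonoidAlgebra

variable {ι : Type*} [Fintype ι] (K : Type*) [Field K] {lam mu : ι → YoungDiagram}
  {α : ι → Type*} [∀ i, Fintype (α i)] [∀ i, DecidableEq (α i)]

/-- The external product of the primitive idempotents attached to a family of fillings. -/
def boxIdempotent (t : ∀ i, Filling (lam i) (α i)) : MonoidAlgebra K (∀ i, Equiv.Perm (α i)) :=
  boxProd fun i => (t i).youngIdempotent K

variable {K}

theorem coeff_one_boxIdempotent_ne_zero [CharZero K] (t : ∀ i, Filling (lam i) (α i)) :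
    (boxIdempotent K t).coeff 1 ≠ 0 :=
  Finset.prod_ne_zero_iff.2 fun i _ => (t i).coeff_one_youngIdempotent_ne_zero

variable [CharZero K]

theorem hasScalarCorner_boxIdempotent (t : ∀ i, Filling (lam i) (α i)) :
    HasScalarCorner K (boxIdempotent K t) :=
  HasScalarCorner.boxProd fun i => (t i).hasScalarCorner_youngIdempotent

theorem boxIdempotent_mul_mul_eq_zero (t : ∀ i, Filling (lam i) (α i))
    (s : ∀ i, Filling (mu i) (α i)) (hne : lam ≠ mu)
    (x : MonoidAlgebra K (∀ i, Equiv.Perm (α i))) :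
    boxIdempotent K t * x * boxIdempotent K s = 0 := by
  obtain ⟨i, hi⟩ := Function.ne_iff.1 hne
  exact boxProd_mul_mul_eq_zero (i := i) ((t i).youngIdempotent_mul_mul_eq_zero (s i) hi) x

/-- The reference tableau of shape `lam`, its labels taken in `Fin m` where `m` is the size. -/
def Filling.ofCard {m : ℕ} (lam : YoungDiagram) (h : lam.card = m) : Filling lam (Fin m) :=
  (finCongr h.symm).trans (tableau lam)

theorem one_mem_span_mul_boxIdempotent_mul (a : ι → ℕ) :
    (1 : MonoidAlgebra K (∀ i, Equiv.Perm (Fin (a i)))) ∈ Submodule.span K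
      {z | ∃ (lam : ι → YoungDiagram) (h : ∀ i, (lam i).card = a i) (x y : _),
        z = x * boxIdempotent K (fun i => .ofCard (lam i) (h i)) * y} := by
  classical
  let diagrams (c : ConjClasses (∀ i, Equiv.Perm (Fin (a i)))) (i : ι) := cycleDiagram (c.out i)
  have card_diagrams (c) (i : ι) : (diagrams c i).card = a i :=
    (card_cycleDiagram _).trans (Fintype.card_fin _)
  have diagrams_injective : Function.Injective diagrams := fun c d hcd => by
    rw [← Quot.out_eq c, ← Quot.out_eq d]
    exact ConjClasses.mk_eq_mk_iff_isConj.2 (isConj_of_forall_cycleDiagram_eq (congrFun hcd))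
  cases nonempty_fintype (ConjClasses (∀ i, Equiv.Perm (Fin (a i))))
  refine Submodule.span_mono ?_ (one_mem_span_mul_mul
    (e := fun c => boxIdempotent K fun i => .ofCard (diagrams c i) (card_diagrams c i))
    (fun c => hasScalarCorner_boxIdempotent _) (fun c => coeff_one_boxIdempotent_ne_zero _)
    (fun c d hcd => boxIdempotent_mul_mul_eq_zero _ _ (diagrams_injective.ne hcd)) le_rfl)
  rintro z ⟨c, x, y, rfl⟩
  exact ⟨diagrams c, card_diagrams c, x, y, rfl⟩

end BoxIdempotent

/-! ### Specht modules as left ideals generated by idempotents -/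

section Specht

open MonoidAlgebra

theorem sum_coeff_smul_of {K G : Type*} [Semiring K] [Monoid G] [Fintype G]
    (x : MonoidAlgebra K G) : ∑ g, x.coeff g • of K G g = x := by
  ext g
  simp

theorem rowSymmetrizer_tableau (lam : YoungDiagram) :
    Filling.rowSymmetrizer ℂ (tableau lam) = rowSymmetrizer lam :=
  Finset.sum_congr rfl fun _ _ => one_smul ℂ _

theorem youngSymmetrizer_tableau (lam : YoungDiagram) :
    Filling.youngSymmetrizer ℂ (tableau lam) = colAntisymmetrizer lam * rowSymmetrizer lam :=
  congrArg (colAntisymmetrizer lam * ·) (rowSymmetrizer_tableau lam)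

theorem youngIdempotent_mem_specht (lam : YoungDiagram) :
    Filling.youngIdempotent ℂ (tableau lam) ∈ Specht lam :=
  (Specht lam).smul_of_tower_mem _ <| youngSymmetrizer_tableau lam ▸
    Submodule.mem_span_singleton_self _

theorem mul_youngIdempotent_of_mem_specht {lam : YoungDiagram} {x : SymAlgebra lam}
    (hx : x ∈ Specht lam) : x * Filling.youngIdempotent ℂ (tableau lam) = x := by
  obtain ⟨y, rfl⟩ := Submodule.mem_span_singleton.1 hx
  rw [← youngSymmetrizer_tableau, smul_eq_mul, mul_assoc,
    Filling.youngSymmetrizer_mul_youngIdempotent]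

/-- The generator of the Specht module which is an idempotent of the group algebra. -/
def spechtGenerator (lam : YoungDiagram) : Specht lam := ⟨_, youngIdempotent_mem_specht lam⟩

theorem sum_coeff_smul_spechtRep {lam : YoungDiagram} (x : Specht lam) :
    ∑ g, (x : SymAlgebra lam).coeff g • spechtRep lam g (spechtGenerator lam) = x := by
  refine Subtype.ext ?_
  rw [AddSubmonoidClass.coe_finsetSum]
  conv_rhs => rw [← mul_youngIdempotent_of_mem_specht x.2, ← sum_coeff_smul_of x.1, Finset.sum_mul]
  exact Finset.sum_congr rfl fun g _ => (smul_mul_assoc _ _ _).symm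

variable {n : ℕ} (lam : Fin n → YoungDiagram)

/-- The embedding of the external product of Specht modules into the group algebra. -/
def spechtBoxEmbedding : (⨂[ℂ] i, Specht (lam i)) →ₗ[ℂ]
    MonoidAlgebra ℂ (∀ i, Equiv.Perm (Fin (lam i).card)) :=
  PiTensorProduct.lift (boxProd.compLinearMap fun i => (Specht (lam i)).subtype.restrictScalars ℂ)

theorem spechtBoxEmbedding_tprod (x : ∀ i, Specht (lam i)) :
    spechtBoxEmbedding lam (PiTensorProduct.tprod ℂ x) =
      boxProd fun i => (x i : SymAlgebra (lam i)) :=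
  PiTensorProduct.lift.tprod x

theorem spechtBoxRep_tprod (g : ∀ i, Equiv.Perm (Fin (lam i).card)) (x : ∀ i, Specht (lam i)) :
    spechtBoxRep lam g (PiTensorProduct.tprod ℂ x) =
      PiTensorProduct.tprod ℂ fun i => spechtRep (lam i) (g i) (x i) :=
  PiTensorProduct.map_tprod _ _

theorem spechtBoxEmbedding_spechtBoxRep (g : ∀ i, Equiv.Perm (Fin (lam i).card))
    (v : ⨂[ℂ] i, Specht (lam i)) :
    spechtBoxEmbedding lam (spechtBoxRep lam g v) = of ℂ _ g * spechtBoxEmbedding lam v := by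
  induction v using PiTensorProduct.induction_on with
  | smul_tprod r x =>
    rw [map_smul, map_smul, map_smul, mul_smul_comm, spechtBoxRep_tprod, spechtBoxEmbedding_tprod,
      spechtBoxEmbedding_tprod, ← boxProd_of, boxProd_mul]
    rfl
  | add v w hv hw =>
    rw [(spechtBoxRep lam g).map_add, (spechtBoxEmbedding lam).map_add,
      (spechtBoxEmbedding lam).map_add, mul_add, hv, hw]

/-- The external product of the generators of Specht modules. -/
def spechtBoxGenerator : ⨂[ℂ] i, Specht (lam i) :=
  PiTensorProduct.tprod ℂ fun i => spechtGenerator (lam i)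

theorem spechtBoxEmbedding_generator :
    spechtBoxEmbedding lam (spechtBoxGenerator lam) = boxIdempotent ℂ fun i => tableau (lam i) :=
  spechtBoxEmbedding_tprod lam _

theorem sum_coeff_smul_spechtBoxRep (v : ⨂[ℂ] i, Specht (lam i)) :
    ∑ g, (spechtBoxEmbedding lam v).coeff g • spechtBoxRep lam g (spechtBoxGenerator lam) = v := by
  induction v using PiTensorProduct.induction_on with
  | smul_tprod r x =>
    simp only [map_smul, coeff_smul, Finsupp.smul_apply, smul_assoc, ← Finset.smul_sum]
    congr 1
    conv_rhs => rw [← funext fun i => sum_coeff_smul_spechtRep (x i), MultilinearMap.map_sum]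
    refine Finset.sum_congr rfl fun g _ => ?_
    rw [MultilinearMap.map_smul_univ, spechtBoxEmbedding_tprod, coeff_boxProd, spechtBoxGenerator,
      spechtBoxRep_tprod]
  | add v w hv hw =>
    simp only [(spechtBoxEmbedding lam).map_add, coeff_add, Finsupp.add_apply, add_smul,
      Finset.sum_add_distrib, hv, hw]

end Specht

/-! ### Indecomposable projectives in abelian categories -/

section Indecomposable

theorem indecomposable_of_forall_eq_zero_or_isIso {C : Type*} [Category* C] [HasZeroMorphisms C]
    [HasBinaryBiproducts C] {X : C} (hX : ¬ IsZero X) (hend : ∀ f : X ⟶ X, f = 0 ∨ IsIso f) :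
    Indecomposable X := by
  refine ⟨hX, fun Y Z e => ?_⟩
  rcases hend (e.hom ≫ biprod.fst ≫ biprod.inl ≫ e.inv) with hzero | hiso
  · left
    have h := congrArg (fun f => biprod.inl ≫ e.inv ≫ f ≫ e.hom ≫ biprod.fst) hzero
    rw [IsZero.iff_id_eq_zero]
    simpa using h
  · right
    have h : (biprod.inr ≫ e.inv : Z ⟶ X) = 0 := by
      rw [← cancel_mono (e.hom ≫ biprod.fst ≫ biprod.inl ≫ e.inv)]
      simp
    rw [IsZero.iff_id_eq_zero]
    simpa using congrArg (fun f => f ≫ e.hom ≫ biprod.snd) h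

theorem eq_zero_of_forall_retract {C : Type*} [Category* C] [HasZeroMorphisms C] {X Y Z W : C}
    (R : Retract X Z) (S : Retract Y W) (h : ∀ x : Z ⟶ W, (R.r ≫ R.i) ≫ x ≫ S.r ≫ S.i = 0)
    (f : X ⟶ Y) : f = 0 := by
  simpa using congrArg (fun x => R.i ≫ x ≫ S.r) (h (R.r ≫ f ≫ S.i))

theorem eq_zero_or_isIso_of_retract {K C : Type*} [Field K] [Category* C] [Preadditive C]
    [Linear K C] {X Z : C} (R : Retract X Z) (hR : HasScalarCorner K (A := End Z) (R.r ≫ R.i))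
    (f : X ⟶ X) : f = 0 ∨ IsIso f := by
  obtain ⟨k, hk⟩ := hR (R.r ≫ f ≫ R.i : Z ⟶ Z)
  replace hk : (R.r ≫ R.i) ≫ (R.r ≫ f ≫ R.i) ≫ R.r ≫ R.i = k • (R.r ≫ R.i) := hk
  have hf : f = k • 𝟙 X := by simpa using congrArg (fun x => R.i ≫ x ≫ R.r) hk
  by_cases hk0 : k = 0
  · exact .inl (by rw [hf, hk0, zero_smul])
  · exact .inr ⟨k⁻¹ • 𝟙 X, by simp [hf, smul_smul, hk0], by simp [hf, smul_smul, hk0]⟩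

variable {C : Type*} [Category* C] [Abelian C]

theorem nonempty_iso_of_retract_of_indecomposable {M X : C} (hM : Indecomposable M)
    (hX : ¬ IsZero X) (R : Retract X M) : Nonempty (M ≅ X) := by
  have hbilimit := isBilimitBinaryBiconeOfIsSplitMonoOfCokernel (cokernelIsCokernel R.i)
  have hcoker : IsZero (cokernel R.i) :=
    (hM.2 X (cokernel R.i) (biprod.uniqueUpToIso _ _ hbilimit)).resolve_left hX
  have : Epi R.i := Preadditive.epi_of_isZero_cokernel R.i hcoker
  have : IsIso R.i := isIso_of_mono_of_epi R.i
  exact ⟨(asIso R.i).symm⟩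

theorem indecomposable_op {X : C} (hX : Indecomposable X) : Indecomposable (Opposite.op X) := by
  refine ⟨fun h0 => hX.1 h0.unop, fun Y Z e => ?_⟩
  have e' : Opposite.op X ≅ Opposite.op (Y.unop ⊞ Z.unop) :=
    e ≪≫ (biprod.opIso Y.unop Z.unop).symm
  exact (hX.2 Y.unop Z.unop e'.unop.symm).imp (fun h => h.op) fun h => h.op

end Indecomposable

/-- The morphisms `p j : F j ⟶ M` are jointly epimorphic, that is, together they generate `M`. -/
def IsJointlyEpic {C J : Type*} [Category* C] [HasZeroMorphisms C] {F : J → C} {M : C}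
    (p : ∀ j, F j ⟶ M) : Prop :=
  ∀ ⦃Y : C⦄ (g : M ⟶ Y), (∀ j, p j ≫ g = 0) → g = 0

namespace IsJointlyEpic

variable {C J : Type*} [Category* C] {F : J → C} {M : C} {p : ∀ j, F j ⟶ M}

theorem isZero [HasZeroMorphisms C] (hp : IsJointlyEpic p) (hzero : ∀ j, p j = 0) : IsZero M :=
  (IsZero.iff_id_eq_zero M).2 (hp (𝟙 M) fun j => by rw [hzero j, zero_comp])

theorem sigma_comp [Preadditive C] (hp : IsJointlyEpic p) {I : J → Type*} [∀ j, Fintype (I j)]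
    {X : ∀ j, I j → C} {α : ∀ j i, F j ⟶ X j i} {β : ∀ j i, X j i ⟶ F j}
    (hid : ∀ j, 𝟙 (F j) = ∑ i, α j i ≫ β j i) :
    IsJointlyEpic fun x : Σ j, I j => β x.1 x.2 ≫ p x.1 := fun Y g hg => hp g fun j => by
  rw [← Category.id_comp (p j ≫ g), hid, Preadditive.sum_comp]
  refine Finset.sum_eq_zero fun i _ => ?_
  rw [Category.assoc, ← Category.assoc (β j i), hg ⟨j, i⟩, comp_zero]

theorem exists_eq_sum_comp [Abelian C] {J : Type} [Fintype J] {F : J → C} {p : ∀ j, F j ⟶ M}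
    (hp : IsJointlyEpic p) {N : C} [Projective N] (f : N ⟶ M) :
    ∃ g : ∀ j, N ⟶ F j, f = ∑ j, g j ≫ p j := by
  have := Abelian.hasFiniteBiproducts (C := C)
  have : Epi (biproduct.desc p) := Preadditive.epi_of_cancel_zero _ fun g hg =>
    hp g fun j => by rw [← biproduct.ι_desc p j, Category.assoc, hg, comp_zero]
  obtain ⟨l, rfl⟩ : ∃ l, l ≫ biproduct.desc p = f := ⟨_, Projective.factorThru_comp f _⟩
  refine ⟨fun j => l ≫ biproduct.π F j, ?_⟩
  simp only [biproduct.desc_eq, Preadditive.comp_sum, Category.assoc]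

end IsJointlyEpic

theorem prop_of_prop_kernel_of_prop_cokernel {C : Type*} [Category* C] [Abelian C] {P : C → Prop}
    (h₂ : ∀ S : ShortComplex C, S.ShortExact → P S.X₁ → P S.X₃ → P S.X₂)
    (h₃ : ∀ S : ShortComplex C, S.ShortExact → P S.X₁ → P S.X₂ → P S.X₃) {Y M : C} (q : Y ⟶ M)
    (hY : P Y) (hK : P (kernel q)) (hQ : P (cokernel q)) : P M := by
  have hker : (ShortComplex.mk (kernel.ι q) (Abelian.factorThruImage q)
      ((cancel_mono (Abelian.image.ι q)).1 (by simp))).ShortExact :=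
    { exact := ShortComplex.exact_of_f_is_kernel _ <|
        isKernelOfComp _ _ (kernelIsKernel q) _ (Abelian.image.fac q) }
  have hcoker : (ShortComplex.mk (Abelian.image.ι q) (cokernel.π q)
      (kernel.condition _)).ShortExact := { exact := ShortComplex.exact_kernel _ }
  exact h₂ _ hcoker (h₃ _ hker hK hY) hQ

/-- A family of projective objects of an abelian category which generates every object by finitely
many members, in which every endomorphism of a member is zero or invertible, and in which the
nonzero morphisms between different members strictly increase the rank `v`. -/
structure IsTriangularFamily {C : Type*} {ι : Type*} [Category* C] [Abelian C] (X : ι → C)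
    (v : ι → ℕ) : Prop where
  projective (i : ι) : Projective (X i)
  not_isZero (i : ι) : ¬ IsZero (X i)
  eq_zero_or_isIso (i : ι) (f : X i ⟶ X i) : f = 0 ∨ IsIso f
  lt_of_ne_zero (i j : ι) (f : X i ⟶ X j) : f ≠ 0 → i ≠ j → v i < v j
  exists_isJointlyEpic (M : C) : ∃ (J : Type) (_ : Fintype J) (k : J → ι)
    (p : ∀ j, X (k j) ⟶ M), IsJointlyEpic p

namespace IsTriangularFamily

variable {C : Type*} {ι : Type*} [Category* C] [Abelian C] {X : ι → C} {v : ι → ℕ}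
  (hX : IsTriangularFamily X v)

include hX

theorem indecomposable (i : ι) : Indecomposable (X i) :=
  indecomposable_of_forall_eq_zero_or_isIso (hX.not_isZero i) (hX.eq_zero_or_isIso i)

theorem le_of_ne_zero {i j : ι} {f : X i ⟶ X j} (hf : f ≠ 0) : v i ≤ v j := by
  by_cases hij : i = j
  · rw [hij]
  · exact (hX.lt_of_ne_zero i j f hf hij).le

theorem eq_and_isIso_of_le {i j : ι} {f : X i ⟶ X j} (hf : f ≠ 0) (hv : v j ≤ v i) :
    i = j ∧ IsIso f := by
  by_cases hij : i = j
  · subst hij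
    exact ⟨rfl, (hX.eq_zero_or_isIso i f).resolve_left hf⟩
  · exact absurd (hX.lt_of_ne_zero i j f hf hij) (not_lt.2 hv)

theorem eq_of_iso {i j : ι} (e : X i ≅ X j) : i = j := by
  have hne {k l : ι} (e : X k ≅ X l) : e.hom ≠ 0 := fun h0 => hX.not_isZero k
    ((IsZero.iff_id_eq_zero _).2 (by rw [← e.hom_inv_id, h0, zero_comp]))
  exact (hX.eq_and_isIso_of_le (hne e) (hX.le_of_ne_zero (hne e.symm))).1

theorem exists_iso_of_projective {M : C} [Projective M] (hM : Indecomposable M) :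
    ∃ i, Nonempty (M ≅ X i) := by
  classical
  obtain ⟨J, _, k, p, hp⟩ := hX.exists_isJointlyEpic M
  have hne : (Finset.univ.filter fun j => p j ≠ 0).Nonempty := by
    by_contra! h0
    exact hM.1 (hp.isZero fun j => not_not.1 (Finset.filter_eq_empty_iff.1 h0 (Finset.mem_univ j)))
  obtain ⟨j₀, hj₀, hmax⟩ := Finset.exists_max_image _ (fun j => v (k j)) hne
  obtain ⟨g, hg⟩ := hp.exists_eq_sum_comp (𝟙 M)
  have hsum : p j₀ = ∑ j, p j₀ ≫ g j ≫ p j := by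
    rw [← Preadditive.comp_sum, ← hg, Category.comp_id]
  obtain ⟨j, -, hj⟩ := Finset.exists_ne_zero_of_sum_ne_zero
    (hsum.symm.trans_ne (Finset.mem_filter.1 hj₀).2)
  have hpj : p j ≠ 0 := fun h0 => hj (by rw [h0, comp_zero, comp_zero])
  have hgj : p j₀ ≫ g j ≠ 0 := fun h0 => hj (by rw [← Category.assoc, h0, zero_comp])
  -- Maximality of the rank of `k j₀` makes `p j₀ ≫ g j` invertible, so `p j₀` is split mono.
  obtain ⟨-, hiso⟩ := hX.eq_and_isIso_of_le hgj (hmax j (by simpa using hpj))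
  exact ⟨k j₀, nonempty_iso_of_retract_of_indecomposable hM (hX.not_isZero _)
    ⟨p j₀, g j ≫ inv (p j₀ ≫ g j), by rw [← Category.assoc, IsIso.hom_inv_id]⟩⟩

theorem eq_zero_of_kernel {k i : ι} {M : C} {q : X k ⟶ M} (hq : q ≠ 0) (hki : v k ≤ v i)
    (f : X i ⟶ kernel q) : f = 0 := by
  by_contra hf
  have hne : f ≫ kernel.ι q ≠ 0 := fun h0 => hf ((cancel_mono (kernel.ι q)).1 (by simpa using h0))
  obtain ⟨-, hiso⟩ := hX.eq_and_isIso_of_le hne hki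
  exact hq ((cancel_epi (f ≫ kernel.ι q)).1 (by simp))

section Induction

variable {P : C → Prop} (hproj : ∀ A : C, Projective A → P A)
  (h₂ : ∀ S : ShortComplex C, S.ShortExact → P S.X₁ → P S.X₃ → P S.X₂)
  (h₃ : ∀ S : ShortComplex C, S.ShortExact → P S.X₁ → P S.X₂ → P S.X₃)

include hproj h₂ h₃

/-- The inner induction of `of_forall_eq_zero`: the morphisms out of the members of maximal rank
factor through the `p j` with `j ∈ s`, and a nonzero `p j` is removed by passing to its cokernel. -/
theorem of_forall_exists_eq_sum {D : ℕ}
    (ih : ∀ M : C, (∀ i, D ≤ v i → ∀ f : X i ⟶ M, f = 0) → P M) {J : Type*} (k : J → ι)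
    (s : Finset J) {M : C} (hM : ∀ i, D < v i → ∀ f : X i ⟶ M, f = 0) (p : ∀ j, X (k j) ⟶ M)
    (hp : ∀ i, v i = D → ∀ f : X i ⟶ M, ∃ g : ∀ j, X i ⟶ X (k j), f = ∑ j ∈ s, g j ≫ p j) :
    P M := by
  classical
  induction s using Finset.induction_on generalizing M with
  | empty =>
    refine ih M fun i hi f => ?_
    rcases hi.eq_or_lt with hi | hi
    · obtain ⟨g, hg⟩ := hp i hi.symm f
      simpa using hg
    · exact hM i hi f
  | insert j s hj ihs =>
    simp only [Finset.sum_insert hj] at hp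
    by_cases hjD : v (k j) = D ∧ p j ≠ 0
    · have := hX.projective
      have hlift (i : ι) (f : X i ⟶ cokernel (p j)) : ∃ f' : X i ⟶ M, f' ≫ cokernel.π (p j) = f :=
        ⟨_, Projective.factorThru_comp f (cokernel.π (p j))⟩
      refine prop_of_prop_kernel_of_prop_cokernel h₂ h₃ (p j) (hproj _ (hX.projective _))
        (ih _ fun i hi => hX.eq_zero_of_kernel hjD.2 (hjD.1.trans_le hi))
        (ihs (fun i hi f => ?_) (fun l => p l ≫ cokernel.π (p j)) fun i hi f => ?_)
      · obtain ⟨f, rfl⟩ := hlift i f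
        rw [hM i hi f, zero_comp]
      · obtain ⟨f, rfl⟩ := hlift i f
        obtain ⟨g, rfl⟩ := hp i hi f
        exact ⟨g, by simp [Preadditive.sum_comp]⟩
    · refine ihs hM p fun i hi f => ?_
      obtain ⟨g, rfl⟩ := hp i hi f
      refine ⟨g, add_eq_right.2 ?_⟩
      by_contra hgp
      have hgj : g j ≠ 0 := fun h0 => hgp (by rw [h0, zero_comp])
      have hpj : p j ≠ 0 := fun h0 => hgp (by rw [h0, comp_zero])
      refine hjD ⟨le_antisymm (not_lt.1 fun h => hpj (hM _ h _)) ?_, hpj⟩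
      exact hi.symm.trans_le (hX.le_of_ne_zero hgj)

theorem of_forall_eq_zero (D : ℕ) (M : C) (hM : ∀ i, D ≤ v i → ∀ f : X i ⟶ M, f = 0) : P M := by
  induction D generalizing M with
  | zero =>
    obtain ⟨J, _, k, p, hp⟩ := hX.exists_isJointlyEpic M
    exact hproj M (hp.isZero fun j => hM _ (Nat.zero_le _) (p j)).projective
  | succ D ih =>
    obtain ⟨J, _, k, p, hp⟩ := hX.exists_isJointlyEpic M
    have := hX.projective
    exact hX.of_forall_exists_eq_sum hproj h₂ h₃ ih k Finset.univ hM p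
      fun i _ f => hp.exists_eq_sum_comp f

theorem induction_shortExact (M : C) : P M := by
  obtain ⟨J, _, k, p, hp⟩ := hX.exists_isJointlyEpic M
  refine hX.of_forall_eq_zero hproj h₂ h₃ (Finset.univ.sup (fun j => v (k j)) + 1) M
    fun i hi f => ?_
  have := hX.projective i
  obtain ⟨g, rfl⟩ := hp.exists_eq_sum_comp f
  refine Finset.sum_eq_zero fun j _ => ?_
  have hgj : g j = 0 := by
    by_contra h0
    have hle : v (k j) ≤ Finset.univ.sup fun j => v (k j) :=
      Finset.le_sup (f := fun j => v (k j)) (Finset.mem_univ j)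
    exact (hi.trans (hX.le_of_ne_zero h0)).not_gt (Nat.lt_succ_of_le hle)
  rw [hgj, zero_comp]

end Induction

end IsTriangularFamily

section Dimension

variable {C : Type*} [Category* C] [Abelian C] {S : ShortComplex C}

theorem projectiveDimension_ne_top_iff_exists_lt {X : C} :
    projectiveDimension X ≠ ⊤ ↔ ∃ m, HasProjectiveDimensionLT X m := by
  rw [projectiveDimension_ne_top_iff]
  exact ⟨fun ⟨m, h⟩ => ⟨m + 1, h⟩, fun ⟨m, h⟩ =>
    ⟨m, hasProjectiveDimensionLT_of_ge X m (m + 1) (by omega)⟩⟩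

theorem injectiveDimension_ne_top_iff_exists_lt {X : C} :
    injectiveDimension X ≠ ⊤ ↔ ∃ m, HasInjectiveDimensionLT X m := by
  rw [injectiveDimension_ne_top_iff]
  exact ⟨fun ⟨m, h⟩ => ⟨m + 1, h⟩, fun ⟨m, h⟩ =>
    ⟨m, hasInjectiveDimensionLT_of_ge X m (m + 1) (by omega)⟩⟩

theorem projectiveDimension_X₂_ne_top (hS : S.ShortExact) (h₁ : projectiveDimension S.X₁ ≠ ⊤)
    (h₃ : projectiveDimension S.X₃ ≠ ⊤) : projectiveDimension S.X₂ ≠ ⊤ := by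
  rw [projectiveDimension_ne_top_iff_exists_lt] at *
  obtain ⟨⟨l, _⟩, m, _⟩ := And.intro h₁ h₃
  exact ⟨l + m, hS.hasProjectiveDimensionLT_X₂ (l + m)
    (hasProjectiveDimensionLT_of_ge _ l _ (by omega))
    (hasProjectiveDimensionLT_of_ge _ m _ (by omega))⟩

theorem projectiveDimension_X₃_ne_top (hS : S.ShortExact) (h₁ : projectiveDimension S.X₁ ≠ ⊤)
    (h₂ : projectiveDimension S.X₂ ≠ ⊤) : projectiveDimension S.X₃ ≠ ⊤ := by
  rw [projectiveDimension_ne_top_iff_exists_lt] at *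
  obtain ⟨⟨l, _⟩, m, _⟩ := And.intro h₁ h₂
  exact ⟨l + m + 1, hS.hasProjectiveDimensionLT_X₃ (l + m)
    (hasProjectiveDimensionLT_of_ge _ l _ (by omega))
    (hasProjectiveDimensionLT_of_ge _ m _ (by omega))⟩

theorem injectiveDimension_X₁_ne_top (hS : S.ShortExact) (h₂ : injectiveDimension S.X₂ ≠ ⊤)
    (h₃ : injectiveDimension S.X₃ ≠ ⊤) : injectiveDimension S.X₁ ≠ ⊤ := by
  rw [injectiveDimension_ne_top_iff_exists_lt] at *
  obtain ⟨⟨l, _⟩, m, _⟩ := And.intro h₂ h₃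
  exact ⟨l + m + 1, hS.hasInjectiveDimensionLT_X₁ (l + m)
    (hasInjectiveDimensionLT_of_ge _ m _ (by omega))
    (hasInjectiveDimensionLT_of_ge _ l _ (by omega))⟩

theorem injectiveDimension_X₂_ne_top (hS : S.ShortExact) (h₁ : injectiveDimension S.X₁ ≠ ⊤)
    (h₃ : injectiveDimension S.X₃ ≠ ⊤) : injectiveDimension S.X₂ ≠ ⊤ := by
  rw [injectiveDimension_ne_top_iff_exists_lt] at *
  obtain ⟨⟨l, _⟩, m, _⟩ := And.intro h₁ h₃
  exact ⟨l + m, hS.hasInjectiveDimensionLT_X₂ (l + m)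
    (hasInjectiveDimensionLT_of_ge _ l _ (by omega))
    (hasInjectiveDimensionLT_of_ge _ m _ (by omega))⟩

theorem IsTriangularFamily.projectiveDimension_ne_top {ι : Type*} {X : ι → C} {v : ι → ℕ}
    (hX : IsTriangularFamily X v) (M : C) : projectiveDimension M ≠ ⊤ :=
  hX.induction_shortExact (P := fun A => projectiveDimension A ≠ ⊤)
    (fun _ _ => projectiveDimension_ne_top_iff_exists_lt.2 ⟨1, inferInstance⟩)
    (fun _ => projectiveDimension_X₂_ne_top) (fun _ => projectiveDimension_X₃_ne_top) M

theorem IsTriangularFamily.injectiveDimension_ne_top {ι : Type*} {X : ι → Cᵒᵖ} {v : ι → ℕ}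
    (hX : IsTriangularFamily X v) (M : C) : injectiveDimension M ≠ ⊤ :=
  hX.induction_shortExact (P := fun A => injectiveDimension A.unop ≠ ⊤)
    (fun _ _ => injectiveDimension_ne_top_iff_exists_lt.2 ⟨1, inferInstance⟩)
    (fun _ hS h₁ h₃ => injectiveDimension_X₂_ne_top hS.unop h₃ h₁)
    (fun _ hS h₁ h₂ => injectiveDimension_X₁_ne_top hS.unop h₂ h₁) (Opposite.op M)

end Dimension

/-! ### Isotypic pieces as retracts -/

namespace UMod

open MonoidAlgebra

variable {n : ℕ}

section Maps

variable {M N P : UMod n} {R S T : WeightedSet n}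

/-- The component at `T` of a morphism of `𝒰`-modules, as a linear map. -/
abbrev appₗ (f : M ⟶ N) (T : WeightedSet n) : M.obj.obj T →ₗ[ℂ] N.obj.obj T :=
  (f.hom.app T).hom.hom

/-- The linear map `M(S) → M(T)` induced by a morphism `S ⟶ T` of weighted sets. -/
abbrev mapₗ (M : UMod n) (φ : S ⟶ T) : M.obj.obj S →ₗ[ℂ] M.obj.obj T :=
  (M.obj.map φ).hom.hom

theorem mapₗ_id (x : M.obj.obj T) : mapₗ M (𝟙 T) x = x := by
  rw [mapₗ, M.obj.map_id]
  rfl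

theorem mapₗ_comp (φ : R ⟶ S) (ψ : S ⟶ T) (x : M.obj.obj R) :
    mapₗ M (φ ≫ ψ) x = mapₗ M ψ (mapₗ M φ x) := by
  rw [mapₗ, M.obj.map_comp]
  rfl

theorem appₗ_mapₗ (f : M ⟶ N) (φ : S ⟶ T) (x : M.obj.obj S) :
    appₗ f T (mapₗ M φ x) = mapₗ N φ (appₗ f S x) :=
  congrArg (fun g => g.hom.hom x) (f.hom.naturality φ)

theorem appₗ_comp (f : M ⟶ N) (g : N ⟶ P) (x : M.obj.obj T) :
    appₗ (f ≫ g) T x = appₗ g T (appₗ f T x) := rfl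

theorem appₗ_eq_zero_of_iso {f : M ⟶ N} (e : S ≅ T) (hf : appₗ f T = 0) : appₗ f S = 0 := by
  ext x
  rw [← mapₗ_id x, ← e.hom_inv_id, mapₗ_comp, appₗ_mapₗ, hf]
  exact map_zero _

theorem hom_ext_apply {f g : M ⟶ N} (h : ∀ T x, appₗ f T x = appₗ g T x) : f = g :=
  hom_ext' fun T => LinearMap.ext (h T)

/-- The morphism of `𝒰`-modules with the given natural family of components. -/
def homOfLinear (f : ∀ T, M.obj.obj T →ₗ[ℂ] N.obj.obj T)
    (hf : ∀ (S T : WeightedSet n) (φ : S ⟶ T) (x : M.obj.obj S),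
      f T (mapₗ M φ x) = mapₗ N φ (f S x)) : M ⟶ N :=
  ObjectProperty.homMk
    { app T := FGModuleCat.ofHom (f T)
      naturality S T φ := by
        ext x
        exact hf S T φ x }

theorem injective_appₗ (f : M ⟶ N) [Mono f] (T : WeightedSet n) :
    Function.Injective (appₗ f T) := by
  have : Mono f.hom := by
    let K : UMod n := ⟨kernel f.hom, (HasFiniteSupport n).prop_of_mono (kernel.ι f.hom) M.property⟩
    let k : K ⟶ M := ObjectProperty.homMk (kernel.ι f.hom)
    have hk : k = 0 := by
      rw [← cancel_mono f, zero_comp]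
      ext1
      exact kernel.condition f.hom
    exact Preadditive.mono_of_kernel_zero (congrArg (fun z => z.hom) hk)
  have : Mono ((forget₂ (FGModuleCat.{0} ℂ) (ModuleCat ℂ)).map (f.hom.app T)) := inferInstance
  exact (ModuleCat.mono_iff_injective _).1 this

theorem surjective_appₗ (f : M ⟶ N) [Epi f] (T : WeightedSet n) :
    Function.Surjective (appₗ f T) := by
  have : Epi f.hom := by
    let K : UMod n := ⟨cokernel f.hom,
      (HasFiniteSupport n).prop_of_epi (cokernel.π f.hom) N.property⟩
    let k : N ⟶ K := ObjectProperty.homMk (cokernel.π f.hom)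
    have hk : k = 0 := by
      rw [← cancel_epi f, comp_zero]
      ext1
      exact cokernel.condition f.hom
    exact Preadditive.epi_of_cokernel_zero (congrArg (fun z => z.hom) hk)
  have : Epi ((forget₂ (FGModuleCat.{0} ℂ) (ModuleCat ℂ)).map (f.hom.app T)) := inferInstance
  exact (ModuleCat.epi_iff_surjective _).1 this

end Maps

section IsotypicRetract

variable {G V : Type} [Group G] [Fintype G] [AddCommGroup V] [Module ℂ V]
  (ρ : Representation ℂ G V) (M : UMod n) (act : G →* End M)

omit [Fintype G] in
theorem valueRep_mapₗ {S T : WeightedSet n} (φ : S ⟶ T) (g : G) (x : M.obj.obj S) :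
    valueRep M act T g (mapₗ M φ x) = mapₗ M φ (valueRep M act S g x) :=
  (LinearMap.congr_fun (map_valueRep M act φ g) x).symm

theorem appₗ_lift (x : MonoidAlgebra ℂ G) (T : WeightedSet n) (y : M.obj.obj T) :
    appₗ (lift ℂ (End M) G act x) T y = ∑ g, x.coeff g • valueRep M act T g y := by
  let eval : End M →ₗ[ℂ] M.obj.obj T :=
    { toFun f := appₗ f T y, map_add' _ _ := rfl, map_smul' _ _ := rfl }
  rw [lift_apply, Finsupp.sum_fintype x.coeff (fun g r => r • act g) (fun _ => zero_smul _ _)]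
  exact map_sum eval (fun g => x.coeff g • act g) Finset.univ

variable {ρ}

/-- The map `x ↦ (v ↦ j(v) x)` from `M(T)` to `Hom_G(V, M(T))`, for a `G`-equivariant map `j` from
`V` to the group algebra. -/
def toIntertwiningMap {j : V →ₗ[ℂ] MonoidAlgebra ℂ G}
    (hj : ∀ g v, j (ρ g v) = of ℂ G g * j v) (T : WeightedSet n) :
    M.obj.obj T →ₗ[ℂ] ρ.IntertwiningMap (valueRep M act T) where
  toFun x := ⟨{
    toFun v := ∑ g, (j v).coeff g • valueRep M act T g x
    map_add' v w := by
      simp only [map_add, coeff_add, Finsupp.add_apply, add_smul, Finset.sum_add_distrib]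
    map_smul' r v := by
      simp only [map_smul, coeff_smul, Finsupp.smul_apply, smul_assoc, Finset.smul_sum,
        RingHom.id_apply] }, fun h => by
    ext v
    simp only [LinearMap.comp_apply, LinearMap.coe_mk, AddHom.coe_mk, map_sum, map_smul, hj]
    refine Fintype.sum_equiv (Equiv.mulLeft h⁻¹) _ _ fun g => ?_
    rw [of_apply, coeff_single_mul_apply, one_mul, Equiv.coe_mulLeft, ← Module.End.mul_apply,
      ← map_mul, mul_inv_cancel_left]⟩
  map_add' x y := by
    ext v
    simp only [map_add, smul_add, Finset.sum_add_distrib]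
    rfl
  map_smul' r x := by
    ext v
    simp only [map_smul, smul_comm _ r, ← Finset.smul_sum]
    rfl

theorem toIntertwiningMap_apply {j : V →ₗ[ℂ] MonoidAlgebra ℂ G}
    (hj : ∀ g v, j (ρ g v) = of ℂ G g * j v) {T : WeightedSet n} (x : M.obj.obj T) (v : V) :
    toIntertwiningMap M act hj T x v = ∑ g, (j v).coeff g • valueRep M act T g x := rfl

variable [Module.Finite ℂ V] (w : V) {j : V →ₗ[ℂ] MonoidAlgebra ℂ G}
  (hj : ∀ g v, j (ρ g v) = of ℂ G g * j v) (hw : ∀ v, ∑ g, (j v).coeff g • ρ g w = v)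

/-- If `V` is generated by `w` and embedded in the group algebra by `j`, with `v = j(v) w` for all
`v`, then `Hom_G(V, M)` is a retract of `M`, where the inclusion is the evaluation at `w`. -/
def isotypicRetract : Retract (isotypicPiece ρ M act) M where
  i := homOfLinear (fun T => ({ toFun f := f w, map_add' _ _ := rfl, map_smul' _ _ := rfl } :
    ρ.IntertwiningMap (valueRep M act T) →ₗ[ℂ] M.obj.obj T)) fun _ _ _ _ => rfl
  r := homOfLinear (toIntertwiningMap M act hj) fun S T φ x => by
    apply Representation.IntertwiningMap.ext
    ext v
    change toIntertwiningMap M act hj T (mapₗ M φ x) v =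
      mapₗ M φ (toIntertwiningMap M act hj S x v)
    simp only [toIntertwiningMap_apply, valueRep_mapₗ, map_sum, map_smul]
  retract := by
    refine hom_ext_apply fun T (f : ρ.IntertwiningMap (valueRep M act T)) => ?_
    apply Representation.IntertwiningMap.ext
    ext v
    change ∑ g, (j v).coeff g • valueRep M act T g (f w) = f v
    conv_rhs => rw [← hw v, map_sum]
    refine Finset.sum_congr rfl fun g _ => ?_
    rw [map_smul, f.isIntertwining]

theorem isotypicRetract_r_comp_i :
    (isotypicRetract M act w hj hw).r ≫ (isotypicRetract M act w hj hw).i =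
      lift ℂ (End M) G act (j w) :=
  hom_ext_apply fun T x => (appₗ_lift M act (j w) T x).symm

end IsotypicRetract

/-! ### Regular families -/

/-- A family of `𝒰`-modules `F a` with actions of the groups `𝔖_a`, such that `ℂ[𝔖_a]` is the full
endomorphism algebra of `F a` and nonzero morphisms `F a ⟶ F b` exist only if there is a morphism
`b ⟶ a` in `𝒰`. Both the principal projectives and the principal injectives have this property. -/
structure IsRegularFamily (F : (Fin n → ℕ) → UMod n)
    (act : ∀ a : Fin n → ℕ, (∀ i, Equiv.Perm (Fin (a i))) →* End (F a)) : Prop where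
  bijective_lift (a : Fin n → ℕ) : Function.Bijective (lift ℂ (End (F a)) _ (act a))
  nonempty_hom {a b : Fin n → ℕ} {f : F a ⟶ F b} :
    f ≠ 0 → Nonempty (WeightedSet.std b ⟶ WeightedSet.std a)

section SpechtPiece

variable (F : (Fin n → ℕ) → UMod n)
  (act : ∀ a : Fin n → ℕ, (∀ i, Equiv.Perm (Fin (a i))) →* End (F a))

/-- The `𝒰`-module `Hom_{𝔖_a}(M_λ, F_a)`, where `a = (|λ¹|, …, |λⁿ|)`: this is `P_λ` or `I_λ` if `F`
is the family of principal projectives or injectives. -/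
abbrev spechtPiece (lam : Fin n → YoungDiagram) : UMod n :=
  isotypicPiece (V := ⨂[ℂ] i, Specht (lam i)) (spechtBoxRep lam) (F fun i => (lam i).card) (act _)

theorem exists_retract_spechtPiece (lam : Fin n → YoungDiagram) {a : Fin n → ℕ}
    (h : ∀ i, (lam i).card = a i) : ∃ R : Retract (spechtPiece F act lam) (F a), R.r ≫ R.i =
      lift ℂ (End (F a)) _ (act a) (boxIdempotent ℂ fun i => .ofCard (lam i) (h i)) := by
  obtain rfl : (fun i => (lam i).card) = a := funext h
  refine ⟨isotypicRetract _ _ (spechtBoxGenerator lam) (spechtBoxEmbedding_spechtBoxRep lam)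
    (sum_coeff_smul_spechtBoxRep lam), ?_⟩
  rw [isotypicRetract_r_comp_i, spechtBoxEmbedding_generator]
  rfl

theorem exists_id_eq_sum_spechtPiece (a : Fin n → ℕ) :
    ∃ (m : ℕ) (lam : Fin m → Fin n → YoungDiagram) (α : ∀ j, F a ⟶ spechtPiece F act (lam j))
      (β : ∀ j, spechtPiece F act (lam j) ⟶ F a), 𝟙 (F a) = ∑ j, α j ≫ β j := by
  obtain ⟨m, c, z, hz⟩ := Submodule.mem_span_set'.1 (one_mem_span_mul_boxIdempotent_mul (K := ℂ) a)
  choose lam h x y hxy using fun j => (z j).2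
  choose R hR using fun j => exists_retract_spechtPiece F act (lam j) (h j)
  refine ⟨m, lam, fun j => c j • (lift ℂ (End (F a)) _ (act a) (y j) ≫ (R j).r),
    fun j => (R j).i ≫ lift ℂ (End (F a)) _ (act a) (x j), ?_⟩
  have hone := congrArg (lift ℂ (End (F a)) _ (act a)) hz
  rw [map_one, map_sum] at hone
  rw [← End.one_def, ← hone]
  refine Finset.sum_congr rfl fun j _ => ?_
  rw [map_smul, hxy, map_mul, map_mul, ← hR, End.mul_def, End.mul_def, Linear.smul_comp]
  simp only [Category.assoc]

end SpechtPiece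

namespace IsRegularFamily

variable {F : (Fin n → ℕ) → UMod n}
  {act : ∀ a : Fin n → ℕ, (∀ i, Equiv.Perm (Fin (a i))) →* End (F a)}
  (hF : IsRegularFamily F act) {lam mu : Fin n → YoungDiagram}

include hF

theorem not_isZero_spechtPiece (lam : Fin n → YoungDiagram) : ¬ IsZero (spechtPiece F act lam) := by
  intro hzero
  obtain ⟨R, hR⟩ := exists_retract_spechtPiece F act lam fun _ => rfl
  rw [hzero.eq_zero_of_tgt R.r, zero_comp] at hR
  refine coeff_one_boxIdempotent_ne_zero (K := ℂ) (fun i => .ofCard (lam i) rfl) ?_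
  rw [(hF.bijective_lift _).1 (hR.symm.trans (map_zero _).symm)]
  rfl

theorem eq_zero_or_isIso (f : spechtPiece F act lam ⟶ spechtPiece F act lam) : f = 0 ∨ IsIso f := by
  obtain ⟨R, hR⟩ := exists_retract_spechtPiece F act lam fun _ => rfl
  refine eq_zero_or_isIso_of_retract (K := ℂ) R ?_ f
  rw [hR]
  exact (hasScalarCorner_boxIdempotent _).map (hF.bijective_lift _).2

theorem eq_zero_of_card_eq (hcard : ∀ i, (mu i).card = (lam i).card) (hne : lam ≠ mu)
    (f : spechtPiece F act lam ⟶ spechtPiece F act mu) : f = 0 := by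
  obtain ⟨R, hR⟩ := exists_retract_spechtPiece F act lam fun _ => rfl
  obtain ⟨S, hS⟩ := exists_retract_spechtPiece F act mu hcard
  refine eq_zero_of_forall_retract R S (fun x => ?_) f
  obtain ⟨y, rfl⟩ := (hF.bijective_lift _).2 x
  rw [hR, hS, ← End.mul_def, ← End.mul_def, ← map_mul, ← map_mul,
    boxIdempotent_mul_mul_eq_zero _ _ hne.symm, map_zero]

theorem exists_card_ne_and_nonempty_hom {f : spechtPiece F act lam ⟶ spechtPiece F act mu}
    (hf : f ≠ 0) (hne : lam ≠ mu) : (fun i => (mu i).card) ≠ (fun i => (lam i).card) ∧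
      Nonempty (WeightedSet.std (fun i => (mu i).card) ⟶
        WeightedSet.std fun i => (lam i).card) := by
  refine ⟨fun hcard => hf (hF.eq_zero_of_card_eq (congrFun hcard) hne f), ?_⟩
  obtain ⟨R, -⟩ := exists_retract_spechtPiece F act lam fun _ => rfl
  obtain ⟨S, -⟩ := exists_retract_spechtPiece F act mu fun _ => rfl
  refine hF.nonempty_hom (f := R.r ≫ f ≫ S.i) fun hzero => hf ?_
  simpa using congrArg (fun x => R.i ≫ x ≫ S.r) hzero

end IsRegularFamily

end UMod

/-! ### Morphisms between the standard weighted sets -/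

namespace WeightedSet

variable {n : ℕ} {a b : Fin n → ℕ}

/-- The underlying bijection of a morphism between the standard weighted sets. -/
def stdEquiv (φ : std b ⟶ std a) : (Σ i, Fin (b i)) ≃ Σ i, Fin (a i) := φ.toEquiv

theorem fst_le_stdEquiv_fst (φ : std b ⟶ std a) (x : Σ i, Fin (b i)) : x.1 ≤ (stdEquiv φ x).1 :=
  φ.le_weight x

theorem sum_fst_lt_sum_fst {A : Type*} [AddCommMonoid A] [PartialOrder A]
    [IsOrderedCancelAddMonoid A] {f : Fin n → A} (hf : StrictMono f) (φ : std b ⟶ std a)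
    {x : Σ i, Fin (b i)} (hx : x.1 ≠ (stdEquiv φ x).1) :
    ∑ y : Σ i, Fin (b i), f y.1 < ∑ y : Σ i, Fin (a i), f y.1 := by
  rw [← (stdEquiv φ).sum_comp]
  exact Finset.sum_lt_sum (fun y _ => hf.monotone (fst_le_stdEquiv_fst φ y))
    ⟨x, Finset.mem_univ x, hf ((fst_le_stdEquiv_fst φ x).lt_of_ne hx)⟩

theorem exists_fst_ne_stdEquiv_fst (φ : std b ⟶ std a) (h : b ≠ a) :
    ∃ x : Σ i, Fin (b i), x.1 ≠ (stdEquiv φ x).1 := by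
  by_contra! hfst
  refine h (funext fun i => ?_)
  have hcard (c : Fin n → ℕ) : Nat.card {x : Σ i, Fin (c i) // x.1 = i} = c i :=
    (Nat.card_congr (Equiv.sigmaSubtype i)).trans (Nat.card_fin (c i))
  rw [← hcard b, ← hcard a]
  exact Nat.card_congr ((stdEquiv φ).subtypeEquiv fun x => by rw [hfst x])

/-- The total weight of a standard weighted set, where the smallest weight counts as zero. -/
def totalWeight (a : Fin n → ℕ) : ℕ := ∑ x : Σ i, Fin (a i), (x.1 : ℕ)

/-- The sum of `n - i` over the weights `i` of a standard weighted set, which plays the role of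
`totalWeight` for the morphisms in the opposite direction. -/
def totalCoweight (a : Fin n → ℕ) : ℕ := ∑ x : Σ i, Fin (a i), (n - (x.1 : ℕ))

theorem totalWeight_lt (φ : std b ⟶ std a) (h : b ≠ a) : totalWeight b < totalWeight a :=
  (exists_fst_ne_stdEquiv_fst φ h).elim fun _ => sum_fst_lt_sum_fst Fin.val_strictMono φ

theorem totalCoweight_lt (φ : std b ⟶ std a) (h : b ≠ a) : totalCoweight a < totalCoweight b := by
  have hanti : StrictMono fun i : Fin n => OrderDual.toDual (n - (i : ℕ)) :=
    fun i j hij => Nat.sub_lt_sub_left i.2 hij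
  exact (exists_fst_ne_stdEquiv_fst φ h).elim fun _ => sum_fst_lt_sum_fst hanti φ

theorem stdEquiv_fst (φ : std a ⟶ std a) (x : Σ i, Fin (a i)) : (stdEquiv φ x).1 = x.1 := by
  by_contra hne
  exact (sum_fst_lt_sum_fst Fin.val_strictMono φ (Ne.symm hne)).false

theorem stdAct_injective (a : Fin n → ℕ) : Function.Injective (stdAct a) := fun _ _ hgh =>
  Equiv.Perm.sigmaCongrRightHom_injective (congrArg stdEquiv hgh)

theorem stdAct_surjective (a : Fin n → ℕ) : Function.Surjective (stdAct a) := by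
  intro φ
  have hmap (i : Fin n) (x : Fin (a i)) : ∃ y : Fin (a i), stdEquiv φ ⟨i, x⟩ = ⟨i, y⟩ := by
    have hfst := stdEquiv_fst φ ⟨i, x⟩
    generalize stdEquiv φ ⟨i, x⟩ = z at hfst
    obtain ⟨j, y⟩ := z
    obtain rfl : j = i := hfst
    exact ⟨y, rfl⟩
  choose f hf using hmap
  have hinj (i : Fin n) : Function.Injective (f i) := fun x y hxy => by
    have hxy' : stdEquiv φ ⟨i, x⟩ = stdEquiv φ ⟨i, y⟩ := by rw [hf, hf, hxy]
    exact eq_of_heq (Sigma.mk.inj ((stdEquiv φ).injective hxy')).2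
  refine ⟨fun i => Equiv.ofBijective (f i) (Finite.injective_iff_bijective.1 (hinj i)), ?_⟩
  ext ⟨i, x⟩
  exact (hf i x).symm

/-- The bijection `g ↦ (x ↦ g⁻¹ x)` from `𝔖_a` to the endomorphisms of the standard weighted set.
The inverse is the one in `principalProjectiveAct` and `principalInjectiveAct`. -/
def stdActEquiv (a : Fin n → ℕ) : (∀ i, Equiv.Perm (Fin (a i))) ≃ (std a ⟶ std a) :=
  (Equiv.inv _).trans (Equiv.ofBijective (stdAct a) ⟨stdAct_injective a, stdAct_surjective a⟩)

end WeightedSet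

namespace UMod

open WeightedSet MonoidAlgebra

variable {n : ℕ}

/-- The linear bijection from `ℂ[𝔖_a]` to `ℂ[End a]` induced by `stdActEquiv`. -/
def groupAlgebraEquiv (a : Fin n → ℕ) :
    MonoidAlgebra ℂ (∀ i, Equiv.Perm (Fin (a i))) ≃ₗ[ℂ] ((std a ⟶ std a) →₀ ℂ) :=
  (coeffLinearEquiv ℂ).trans (Finsupp.domLCongr (M := ℂ) (R := ℂ) (stdActEquiv a))

theorem groupAlgebraEquiv_apply {a : Fin n → ℕ}
    (x : MonoidAlgebra ℂ (∀ i, Equiv.Perm (Fin (a i)))) :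
    groupAlgebraEquiv a x = ∑ g, x.coeff g • Finsupp.single (stdAct a g⁻¹) 1 := by
  conv_lhs => rw [← sum_coeff_smul_of x, map_sum]
  refine Finset.sum_congr rfl fun g _ => ?_
  rw [map_smul]
  exact congrArg (x.coeff g • ·) (Finsupp.domLCongr_single (M := ℂ) (R := ℂ) (stdActEquiv a) g 1)

/-! ### Principal projectives -/

section PrincipalProjective

variable {M : UMod n} {a : Fin n → ℕ}

/-- The morphism `P_a ⟶ M`, `φ ↦ M(φ) x`, which corresponds to an element of `M(a)` under the Yoneda
lemma. -/
def fromPrincipalProjective (x : M.obj.obj (std a)) : principalProjective a ⟶ M :=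
  homOfLinear (fun T => (Finsupp.linearCombination ℂ fun φ : std a ⟶ T => mapₗ M φ x :
    ((std a ⟶ T) →₀ ℂ) →ₗ[ℂ] M.obj.obj T)) fun S T φ y => by
      have h : (Finsupp.linearCombination ℂ fun ψ : std a ⟶ T => mapₗ M ψ x) ∘ₗ
          (Finsupp.lmapDomain ℂ ℂ fun ψ : std a ⟶ S => ψ ≫ φ) =
          mapₗ M φ ∘ₗ Finsupp.linearCombination ℂ fun ψ : std a ⟶ S => mapₗ M ψ x := by
        ext ψ
        simp [mapₗ_comp]
      exact LinearMap.congr_fun h y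

/-- The universal element of `P_a(a)`, given by the identity of `a`. -/
def universalElement (a : Fin n → ℕ) : (principalProjective a).obj.obj (std a) :=
  (Finsupp.single (𝟙 (std a)) 1 : (std a ⟶ std a) →₀ ℂ)

theorem fromPrincipalProjective_universalElement (x : M.obj.obj (std a)) :
    appₗ (fromPrincipalProjective x) (std a) (universalElement a) = x :=
  (Finsupp.linearCombination_single (v := fun φ : std a ⟶ std a => mapₗ M φ x) ℂ 1
    (𝟙 (std a))).trans (by rw [one_smul, mapₗ_id])

theorem principalProjective_hom_ext {f g : principalProjective a ⟶ M}
    (h : appₗ f (std a) (universalElement a) = appₗ g (std a) (universalElement a)) : f = g := by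
  refine hom_ext' fun T => Finsupp.lhom_ext' fun φ => LinearMap.ext_ring ?_
  have hφ : (Finsupp.single φ 1 : (std a ⟶ T) →₀ ℂ) =
      mapₗ (principalProjective a) φ (universalElement a) := by
    refine Eq.trans ?_ (Finsupp.mapDomain_single (f := fun ψ : std a ⟶ std a => ψ ≫ φ)).symm
    rw [Category.id_comp]
  change appₗ f T (Finsupp.single φ 1 : (std a ⟶ T) →₀ ℂ) =
    appₗ g T (Finsupp.single φ 1 : (std a ⟶ T) →₀ ℂ)
  rw [hφ]
  exact (appₗ_mapₗ f φ _).trans ((congrArg _ h).trans (appₗ_mapₗ g φ _).symm)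

instance projective_principalProjective (a : Fin n → ℕ) : Projective (principalProjective a) where
  factors {E N} f e _ := by
    obtain ⟨x, hx⟩ := surjective_appₗ e (std a) (appₗ f (std a) (universalElement a))
    refine ⟨fromPrincipalProjective x, principalProjective_hom_ext ?_⟩
    rw [appₗ_comp, fromPrincipalProjective_universalElement, hx]

theorem appₗ_lift_universalElement (x : MonoidAlgebra ℂ (∀ i, Equiv.Perm (Fin (a i)))) :
    appₗ (lift ℂ (End (principalProjective a)) _ (principalProjectiveAct a) x) (std a)
      (universalElement a) = groupAlgebraEquiv a x := by
  rw [appₗ_lift, groupAlgebraEquiv_apply]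
  refine Finset.sum_congr rfl fun g _ => congrArg (x.coeff g • ·) ?_
  refine (Finsupp.mapDomain_single (f := fun φ : std a ⟶ std a => stdAct a g⁻¹ ≫ φ)).trans ?_
  rw [Category.comp_id]

theorem isRegularFamily_principalProjective :
    IsRegularFamily (n := n) principalProjective principalProjectiveAct where
  bijective_lift a := by
    refine ⟨fun x y hxy => (groupAlgebraEquiv a).injective ?_, fun f => ?_⟩
    · rw [← appₗ_lift_universalElement, ← appₗ_lift_universalElement, hxy]
    · obtain ⟨x, hx⟩ :=
        (groupAlgebraEquiv a).surjective (appₗ f (std a) (universalElement a))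
      exact ⟨x, principalProjective_hom_ext ((appₗ_lift_universalElement x).trans hx)⟩
  nonempty_hom {a b f} hf := by
    by_contra h
    rw [not_nonempty_iff] at h
    have : Subsingleton ((std b ⟶ std a) →₀ ℂ) := inferInstance
    exact hf (principalProjective_hom_ext (Subsingleton.elim (α := (std b ⟶ std a) →₀ ℂ) _ _))

end PrincipalProjective

/-! ### Principal injectives -/

section PrincipalInjective

variable {M : UMod n} {a : Fin n → ℕ}

/-- The morphism `M ⟶ I_a`, `m ↦ (φ ↦ ξ(M(φ) m))`, which corresponds to a functional on `M(a)` under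
the Yoneda lemma. -/
def toPrincipalInjective (ξ : Module.Dual ℂ (M.obj.obj (std a))) : M ⟶ principalInjective a :=
  homOfLinear (fun T => ({
      toFun m := Finsupp.linearCombination ℂ fun φ : T ⟶ std a => ξ (mapₗ M φ m)
      map_add' m m' := by ext φ; simp
      map_smul' r m := by ext φ; simp } :
    M.obj.obj T →ₗ[ℂ] Module.Dual ℂ ((T ⟶ std a) →₀ ℂ))) fun S T φ m => by
      change Finsupp.linearCombination ℂ (fun ψ : T ⟶ std a => ξ (mapₗ M ψ (mapₗ M φ m))) =
        Finsupp.linearCombination ℂ (fun ψ : S ⟶ std a => ξ (mapₗ M ψ m)) ∘ₗ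
          Finsupp.lmapDomain ℂ ℂ fun ψ : T ⟶ std a => φ ≫ ψ
      ext ψ
      simp [mapₗ_comp]

/-- The universal functional on `I_a(a)`, given by evaluation at the identity of `a`. -/
def universalFunctional (a : Fin n → ℕ) :
    Module.Dual ℂ ((principalInjective a).obj.obj (std a)) :=
  (LinearMap.applyₗ (Finsupp.single (𝟙 (std a)) 1 : (std a ⟶ std a) →₀ ℂ) :
    Module.Dual ℂ ((std a ⟶ std a) →₀ ℂ) →ₗ[ℂ] ℂ)

theorem universalFunctional_toPrincipalInjective (ξ : Module.Dual ℂ (M.obj.obj (std a)))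
    (x : M.obj.obj (std a)) :
    universalFunctional a (appₗ (toPrincipalInjective ξ) (std a) x) = ξ x :=
  (Finsupp.linearCombination_single ℂ 1 (𝟙 (std a))).trans (by rw [one_smul, mapₗ_id])

theorem principalInjective_hom_ext {f g : M ⟶ principalInjective a}
    (h : ∀ x, universalFunctional a (appₗ f (std a) x) =
      universalFunctional a (appₗ g (std a) x)) : f = g := by
  refine hom_ext_apply fun T m => Finsupp.lhom_ext' fun φ => LinearMap.ext_ring ?_
  have hφ (u : Module.Dual ℂ ((T ⟶ std a) →₀ ℂ)) : u (Finsupp.single φ 1) =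
      universalFunctional a (mapₗ (principalInjective a) φ u) := by
    refine congrArg u (Eq.trans ?_
      (Finsupp.mapDomain_single (f := fun ψ : std a ⟶ std a => φ ≫ ψ)).symm)
    rw [Category.comp_id]
  refine (hφ _).trans (Eq.trans ?_ (hφ _).symm)
  exact (congrArg _ (appₗ_mapₗ f φ m).symm).trans ((h _).trans (congrArg _ (appₗ_mapₗ g φ m)))

instance injective_principalInjective (a : Fin n → ℕ) : Injective (principalInjective a) where
  factors {M N} f e _ := by
    obtain ⟨l, hl⟩ := (appₗ e (std a)).exists_leftInverse_of_injective
      (LinearMap.ker_eq_bot.2 (injective_appₗ e (std a)))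
    refine ⟨toPrincipalInjective ((universalFunctional a ∘ₗ appₗ f (std a)) ∘ₗ l),
      principalInjective_hom_ext fun x => ?_⟩
    rw [appₗ_comp, universalFunctional_toPrincipalInjective]
    exact congrArg (fun y => universalFunctional a (appₗ f (std a) y)) (LinearMap.congr_fun hl x)

theorem universalFunctional_lift (x : MonoidAlgebra ℂ (∀ i, Equiv.Perm (Fin (a i))))
    (u : Module.Dual ℂ ((std a ⟶ std a) →₀ ℂ)) :
    universalFunctional a
      (appₗ (lift ℂ (End (principalInjective a)) _ (principalInjectiveAct a) x) (std a) u) =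
      u (groupAlgebraEquiv a x) := by
  refine (congrArg (universalFunctional a)
    (appₗ_lift _ (principalInjectiveAct a) x (std a) u)).trans ?_
  simp only [groupAlgebraEquiv_apply, map_sum, map_smul]
  refine Finset.sum_congr rfl fun g _ => congrArg (x.coeff g • ·) (congrArg u ?_)
  refine (Finsupp.mapDomain_single (f := fun φ : std a ⟶ std a => φ ≫ stdAct a g⁻¹)).trans ?_
  rw [Category.id_comp]

theorem isRegularFamily_principalInjective :
    IsRegularFamily (n := n) principalInjective principalInjectiveAct where
  bijective_lift a := by
    let double_dual := Module.evalEquiv ℂ ((std a ⟶ std a) →₀ ℂ)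
    refine ⟨fun x y hxy => ((groupAlgebraEquiv a).trans double_dual).injective ?_, fun f => ?_⟩
    · ext1 u
      refine (universalFunctional_lift x u).symm.trans
        (Eq.trans ?_ (universalFunctional_lift y u))
      rw [hxy]
    · obtain ⟨x, hx⟩ := ((groupAlgebraEquiv a).trans double_dual).surjective
        (universalFunctional a ∘ₗ appₗ f (std a))
      exact ⟨x, principalInjective_hom_ext fun u =>
        (universalFunctional_lift x u).trans (LinearMap.congr_fun hx u)⟩
  nonempty_hom {a b f} hf := by
    by_contra h
    rw [not_nonempty_iff] at h
    refine hf (principalInjective_hom_ext fun u => ?_)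
    have : Subsingleton (Module.Dual ℂ ((std b ⟶ std a) →₀ ℂ)) := inferInstance
    obtain rfl : u = 0 := Subsingleton.elim (α := Module.Dual ℂ ((std b ⟶ std a) →₀ ℂ)) _ _
    rw [map_zero, map_zero]
    exact (map_zero (universalFunctional b)).symm

end PrincipalInjective

/-! ### Indecomposable projective and injective `𝒰`-modules -/

theorem exists_fintype_iso_std (M : UMod n) : ∃ (J : Type) (_ : Fintype J) (b : J → Fin n → ℕ),
    ∀ T : WeightedSet n, Nontrivial (M.obj.obj T) → ∃ j, Nonempty (T ≅ std (b j)) := by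
  obtain ⟨s, hs, hsM⟩ := M.property
  choose b hb using exists_iso_std (n := n)
  refine ⟨b '' s, (hs.image b).fintype, Subtype.val, fun T hT => ?_⟩
  obtain ⟨S, hS, ⟨f⟩⟩ := hsM T hT
  exact ⟨⟨b S, S, hS, rfl⟩, ⟨f ≪≫ (hb S).some⟩⟩

theorem exists_isJointlyEpic_principalProjective (M : UMod n) :
    ∃ (J : Type) (_ : Fintype J) (b : J → Fin n → ℕ) (p : ∀ j, principalProjective (b j) ⟶ M),
      IsJointlyEpic p := by
  obtain ⟨J, _, b, hb⟩ := exists_fintype_iso_std M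
  let basis (j : J) := Module.finBasis ℂ (M.obj.obj (std (b j)))
  refine ⟨Σ j, Fin (Module.finrank ℂ (M.obj.obj (std (b j)))), inferInstance, fun x => b x.1,
    fun x => fromPrincipalProjective (basis x.1 x.2), fun Y g hg => hom_ext' fun T => ?_⟩
  have hstd (j : J) : appₗ g (std (b j)) = 0 := (basis j).ext fun i => by
    have h := congrArg (fun f => appₗ f (std (b j)) (universalElement (b j))) (hg ⟨j, i⟩)
    rwa [appₗ_comp, fromPrincipalProjective_universalElement] at h
  by_contra hT
  obtain ⟨j, ⟨e⟩⟩ := hb T (not_subsingleton_iff_nontrivial.1 fun _ => hT (Subsingleton.elim _ _))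
  exact hT (appₗ_eq_zero_of_iso e (hstd j))

theorem exists_isJointlyEpic_op_principalInjective (M : UMod n) :
    ∃ (J : Type) (_ : Fintype J) (b : J → Fin n → ℕ) (p : ∀ j, M ⟶ principalInjective (b j)),
      IsJointlyEpic fun j => (p j).op := by
  obtain ⟨J, _, b, hb⟩ := exists_fintype_iso_std M
  let basis (j : J) := Module.finBasis ℂ (M.obj.obj (std (b j)))
  refine ⟨Σ j, Fin (Module.finrank ℂ (M.obj.obj (std (b j)))), inferInstance, fun x => b x.1,
    fun x => toPrincipalInjective ((basis x.1).coord x.2),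
    fun Y g hg => Quiver.Hom.unop_inj (hom_ext' fun T => ?_)⟩
  have hstd (j : J) : appₗ g.unop (std (b j)) = 0 := LinearMap.ext fun y =>
    (basis j).ext_elem fun i => by
      have h := congrArg (fun f => universalFunctional (b j) (appₗ f.unop (std (b j)) y))
        (hg ⟨j, i⟩)
      refine (universalFunctional_toPrincipalInjective ((basis j).coord i) _).symm.trans
        (h.trans ?_)
      rw [LinearMap.zero_apply, map_zero]
      exact map_zero (universalFunctional (b j))
  by_contra hT
  obtain ⟨j, ⟨e⟩⟩ := hb T (not_subsingleton_iff_nontrivial.1 fun _ => hT (Subsingleton.elim _ _))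
  exact hT (appₗ_eq_zero_of_iso e (hstd j))

theorem projective_projectiveOf (lam : Fin n → YoungDiagram) : Projective (projectiveOf lam) :=
  (exists_retract_spechtPiece principalProjective principalProjectiveAct lam fun _ => rfl).elim
    fun R _ => R.projective

theorem injective_injectiveOf (lam : Fin n → YoungDiagram) : Injective (injectiveOf lam) :=
  (exists_retract_spechtPiece principalInjective principalInjectiveAct lam fun _ => rfl).elim
    fun R _ => R.injective

theorem isTriangularFamily_projectiveOf :
    IsTriangularFamily (projectiveOf (n := n)) fun lam => totalCoweight fun i => (lam i).card where
  projective := projective_projectiveOf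
  not_isZero := isRegularFamily_principalProjective.not_isZero_spechtPiece
  eq_zero_or_isIso _ := isRegularFamily_principalProjective.eq_zero_or_isIso
  lt_of_ne_zero lam mu f hf hne := by
    obtain ⟨hcard, ⟨φ⟩⟩ :=
      isRegularFamily_principalProjective.exists_card_ne_and_nonempty_hom hf hne
    exact totalCoweight_lt φ hcard
  exists_isJointlyEpic M := by
    obtain ⟨J, _, b, p, hp⟩ := exists_isJointlyEpic_principalProjective M
    choose m lam α β hid using fun j =>
      exists_id_eq_sum_spechtPiece principalProjective principalProjectiveAct (b j)
    exact ⟨Σ j, Fin (m j), inferInstance, fun x => lam x.1 x.2, _, hp.sigma_comp hid⟩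

theorem isTriangularFamily_op_injectiveOf :
    IsTriangularFamily (fun lam => Opposite.op (injectiveOf (n := n) lam))
      fun lam => totalWeight fun i => (lam i).card where
  projective lam := Injective.injective_iff_projective_op.1 (injective_injectiveOf lam)
  not_isZero lam h := isRegularFamily_principalInjective.not_isZero_spechtPiece lam h.unop
  eq_zero_or_isIso lam f :=
    (isRegularFamily_principalInjective.eq_zero_or_isIso f.unop).imp
      (fun h => Quiver.Hom.unop_inj h) (isIso_unop_iff f).1
  lt_of_ne_zero lam mu f hf hne := by
    have hf' : f.unop ≠ 0 := fun h => hf (Quiver.Hom.unop_inj h)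
    obtain ⟨hcard, ⟨φ⟩⟩ :=
      isRegularFamily_principalInjective.exists_card_ne_and_nonempty_hom hf' hne.symm
    exact totalWeight_lt φ hcard
  exists_isJointlyEpic M := by
    obtain ⟨J, _, b, p, hp⟩ := exists_isJointlyEpic_op_principalInjective M.unop
    choose m lam α β hid using fun j =>
      exists_id_eq_sum_spechtPiece principalInjective principalInjectiveAct (b j)
    have hid_op (j : J) : 𝟙 (Opposite.op (principalInjective (b j))) =
        ∑ i, (β j i).op ≫ (α j i).op := by
      rw [← op_id, hid j, op_sum]
      rfl
    exact ⟨Σ j, Fin (m j), inferInstance, fun x => lam x.1 x.2, _, hp.sigma_comp hid_op⟩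

theorem indecomposable_injectiveOf (lam : Fin n → YoungDiagram) :
    Indecomposable (injectiveOf lam) :=
  indecomposable_of_forall_eq_zero_or_isIso
    (isRegularFamily_principalInjective.not_isZero_spechtPiece lam)
    isRegularFamily_principalInjective.eq_zero_or_isIso

theorem exists_iso_injectiveOf {M : UMod n} [Injective M] (hM : Indecomposable M) :
    ∃ lam, Nonempty (M ≅ injectiveOf lam) := by
  obtain ⟨lam, ⟨e⟩⟩ :=
    isTriangularFamily_op_injectiveOf.exists_iso_of_projective (indecomposable_op hM)
  exact ⟨lam, ⟨e.unop.symm⟩⟩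

end UMod

end

theorem mainTheorem9 (n : ℕ) (hn : 1 ≤ n) :
    -- the `I_λ` are a complete irredundant set of indecomposable injectives
    ((∀ lam : Fin n → YoungDiagram,
        Injective (UMod.injectiveOf lam) ∧ Indecomposable (UMod.injectiveOf lam)) ∧
      (∀ M : UMod n, Injective M → Indecomposable M →
        ∃ lam : Fin n → YoungDiagram, Nonempty (M ≅ UMod.injectiveOf lam)) ∧
      (∀ lam mu : Fin n → YoungDiagram,
        Nonempty (UMod.injectiveOf lam ≅ UMod.injectiveOf mu) → lam = mu)) ∧
    -- the `P_λ` are a complete irredundant set of indecomposable projectives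
    ((∀ lam : Fin n → YoungDiagram,
        Projective (UMod.projectiveOf lam) ∧ Indecomposable (UMod.projectiveOf lam)) ∧
      (∀ M : UMod n, Projective M → Indecomposable M →
        ∃ lam : Fin n → YoungDiagram, Nonempty (M ≅ UMod.projectiveOf lam)) ∧
      (∀ lam mu : Fin n → YoungDiagram,
        Nonempty (UMod.projectiveOf lam ≅ UMod.projectiveOf mu) → lam = mu)) ∧
    -- every `𝒰`-module has finite injective and projective dimension
    (∀ M : UMod n, injectiveDimension M ≠ ⊤ ∧ projectiveDimension M ≠ ⊤) := by
  have hI := UMod.isTriangularFamily_op_injectiveOf (n := n)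
  have hP := UMod.isTriangularFamily_projectiveOf (n := n)
  exact ⟨⟨fun lam => ⟨UMod.injective_injectiveOf lam, UMod.indecomposable_injectiveOf lam⟩,
      fun _ _ hM => UMod.exists_iso_injectiveOf hM,
      fun _ _ ⟨e⟩ => hI.eq_of_iso e.symm.op⟩,
    ⟨fun lam => ⟨UMod.projective_projectiveOf lam, hP.indecomposable lam⟩,
      fun _ _ hM => hP.exists_iso_of_projective hM,
      fun _ _ ⟨e⟩ => hP.eq_of_iso e⟩,
    fun M => ⟨hI.injectiveDimension_ne_top M, hP.projectiveDimension_ne_top M⟩⟩
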